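/- **Proposition.** Let $\Sigma=(B,K,O,\mathrm{ar},\mathrm{car})$ be a $\lambda_c$-signature: $B$ is a set of base types, $K$ a set of effect-free constants, $O$ a set of algebraic operations, and each $c\in K$ and $o\in O$ has an arity and a coarity that are ground types ($b \mid 1 \mid \rho\times\tau \mid 0\mid \rho+\tau$, $b \in B$). The source language is the $\lambda_c$-calculus over $\Sigma$, with types $\rho,\tau ::= b\mid 1\mid\rho\times\tau\mid 0\mid\rho+\tau\mid\rho\to\tau$ and well-typed terms built from variables, $c\,M$, $o_\rho\,M$ (with $M:(\mathrm{ar}(o)\to\rho)\times\mathrm{car}(o)$), tuples, projections, case analyses, injections, $\lambda$-abstraction, application and recursion $\mathtt{let\ rec}\ f\,x=M\ \mathtt{in}\ N$. The target language has types $R\mid b\mid 1\mid\rho\times\tau\mid 0\mid\rho+\tau\mid\rho\to R$, the analogous terms (with $o\,M:R$ for $M:(\mathrm{ar}(o)\to R)\times \mathrm{car}(o)$, and case analyses valued in $R$), and fixed points $\mathtt{let\ rec}\ f\,x=M\ \mathtt{in}\ N$ with $f:\rho\to R$ and $M:R$. Let $\mathcal A=(\mathcal C,T,A,a)$ be an $\omega\mathbf{CPO}$-enriched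 $\lambda_c(\Sigma)$-structure: $\mathcal C$ is an $\omega\mathbf{CPO}$-enriched bicartesian closed category; $T$ is a strong monad with a morphism $\bot:1\to T0$ such that $T!\circ\bot:1\to TX$ is the least morphism for every $X$; $A$ interprets the base types as objects of $\mathcal C$; and $a$ assigns to each $c\in K$ a morphism $[\![\mathrm{ar}(c)]\!]\to[\![\mathrm{car}(c)]\!]$ and to each $o \in O$ an $([\![\mathrm{ar}(o)]\!],[\![\mathrm{car}(o)]\!])$-ary algebraic operation for $T$. Let $\nu:T\Omega\to\Omega$ be an Eilenberg–Moore $T$-algebra, let $K_\Omega X=(X\Rightarrow\Omega)\Rightarrow\Omega$ be the continuation monad, and let $\phi^\nu:T\to K_\Omega$ be the strong monad morphism with components $\Lambda(\nu\circ T\,\mathrm{ev}\circ\mathrm{st}\circ\beta)$, where $\Lambda$ is currying, $\mathrm{st}$ the strength of $T$ and $\beta$ the symmetry. Write * $(\phi^\nu\mathcal A)[\![M]\!]:(\phi^\nu\mathcal A)[\![\Gamma]\!]\to K_\Omega(\phi^\nu\mathcal A)[\![\rho]\!]$ for the call-by-value interpretation of a source term $\Gamma\vdash M:\rho$ in the structure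 $\phi^\nu\mathcal A$ whose monad is $K_\Omega$, whose operations are transported along $\phi^\nu$, and whose base-type and constant interpretations are those of $\mathcal A$; * $\mathcal A^\nu[\![M]\!]:\mathcal A^\nu[\![\Gamma]\!]\to\mathcal A^\nu[\![\rho]\!]$ for the interpretation of a target term as in the simply typed $\lambda$-calculus, with $R$ interpreted as $\Omega$ and $\mathcal A^\nu[\![o\,M]\!]=\nu\circ T\,\mathrm{ev}\circ\mathrm{st}\circ(\mathrm{id}\times g_o)\circ\mathcal A^\nu[\![M]\!]$, where $g_o:[\![\mathrm{car}(o)]\!]\to T[\![\mathrm{ar}(o)]\!]$ is the generic effect of $a(o)$. In both interpretations $[\![\mathtt{let\ rec}\ f\,x=M\ \mathtt{in}\ N]\!]=[\![N]\!]\circ\langle\mathrm{id},(\Lambda[\![M]\!])^\dagger\rangle$, where for $g:X\times Y\to Y$ and an Eilenberg–Moore algebra on $Y$ (here the one on the exponential that interprets the type of $f$) the morphism $g^\dagger:X\to Y$ is the supremum of the $\omega$-chain $g^{(0)}=\bot$, the least morphism $X\to Y$, $g^{(n+1)}=g\circ\langle\mathrm{id},g^{(n)}\rangle$. The CPS transformation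 sends types to target types by $(\rho\to\tau)^{\mathrm{CPS}}=(\rho^{\mathrm{CPS}}\times(\tau^{\mathrm{CPS}}\to R))\to R$ and homomorphically otherwise, and a source term $\Gamma\vdash M:\rho$ to a target term $\Gamma^{\mathrm{CPS}}\vdash M^{\mathrm{CPS}}:(\rho^{\mathrm{CPS}}\to R)\to R$ by $$\begin{aligned} x&\mapsto\lambda k.\,k\,x, & c\,M&\mapsto\lambda k.\,M^{\mathrm{CPS}}(\lambda m.\,k\,(c\,m)),\\ ()&\mapsto\lambda k.\,k\,(), & o_\rho\,M&\mapsto\lambda k.\,M^{\mathrm{CPS}}(\lambda(m_1,m_2).\,o\,(\lambda x.\,m_1(x,k),\,m_2)),\\ \pi_iM&\mapsto\lambda k.\,M^{\mathrm{CPS}}(\lambda m.\,k\,(\pi_i m)), & (M_1,M_2)&\mapsto\lambda k.\,M_1^{\mathrm{CPS}}(\lambda m_1.\,M_2^{\mathrm{CPS}}(\lambda m_2.\,k\,(m_1,m_2))),\\ \iota_iM&\mapsto\lambda k.\,M^{\mathrm{CPS}}(\lambda m.\,k\,(\iota_i m)), & \delta(M,x_1.M_1,x_2.M_2)&\mapsto\lambda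 k.\,M^{\mathrm{CPS}}(\lambda m.\,\delta(m,x_1.M_1^{\mathrm{CPS}}k,x_2.M_2^{\mathrm{CPS}}k)),\\ \delta(M)&\mapsto\lambda k.\,M^{\mathrm{CPS}}(\lambda m.\,\delta(m)), & M\,N&\mapsto\lambda k.\,M^{\mathrm{CPS}}(\lambda m.\,N^{\mathrm{CPS}}(\lambda n.\,m\,(n,k))),\\ \lambda x.M&\mapsto\lambda k.\,k\,(\lambda(x,h).\,M^{\mathrm{CPS}}h), & \mathtt{let\ rec}\ f\,x=M\ \mathtt{in}\ N&\mapsto\mathtt{let\ rec}\ f\,(x,k)=M^{\mathrm{CPS}}k\ \mathtt{in}\ N^{\mathrm{CPS}}. \end{aligned}$$ There is a canonical family of isomorphisms $\psi_\rho:\mathcal A^\nu[\![\rho^{\mathrm{CPS}}]\!]\to(\phi^\nu\mathcal A)[\![\rho]\!]$, one for each source type $\rho$, namely: $\psi_\rho$ is the identity for $\rho=b,1,0$; $\psi_{\rho\times\tau}=\psi_\rho\times\psi_\tau$; $\psi_{\rho+\tau}=\psi_\rho+\psi_\tau$; and $\psi_{\rho\to\tau}$ is the currying isomorphism followed by transport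 along $\psi_\rho$ and $\psi_\tau$, i.e. $m\mapsto\lambda x.\lambda k.\,m(\psi_\rho^{-1}x,\ \lambda q.\,k(\psi_\tau q))$. Let $\psi_\Gamma$ be the product of the $\psi_{\rho_i}$ for $\Gamma=x_1:\rho_1,\dots,x_n:\rho_n$. Then for every well-typed source term $\Gamma\vdash M:\rho$, possibly with recursion, $$(\phi^\nu\mathcal A)[\![M]\!]\circ\psi_\Gamma=K_\Omega\psi_\rho\circ\mathcal A^\nu[\![M^{\mathrm{CPS}}]\!].$$ Moreover, $\psi_\rho$ is the identity whenever $\rho$ is a ground type. -/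

import Mathlib

open CategoryTheory Category Limits MonoidalCategory CartesianMonoidalCategory

universe v u uB uK uO

set_option linter.unusedSimpArgs false

namespace LamCPS

noncomputable section

/-! ### Cartesian closed structure, with the exponent on the right -/

section CCC

variable {C : Type u} [Category.{v} C] [CartesianMonoidalCategory C] [MonoidalClosed C]

/-- The exponential `X ⇒ Y`. -/
abbrev Exp (X Y : C) : C := (ihom X).obj Y

/-- Currying `Λ : C(X × Y, Z) → C(X, Y ⇒ Z)`. -/
def lam {X Y Z : C} (f : X ⊗ Y ⟶ Z) : X ⟶ Exp Y Z :=
  MonoidalClosed.curry (lift (snd Y X) (fst Y X) ≫ f)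

/-- Evaluation `ev : (X ⇒ Y) × X → Y`. -/
def ev (X Y : C) : Exp X Y ⊗ X ⟶ Y :=
  lift (snd _ _) (fst _ _) ≫ (ihom.ev X).app Y

/-- The application of `h` to `y`, i.e. `ev ∘ ⟨h, y⟩`. -/
def app {W Y Z : C} (h : W ⟶ Exp Y Z) (y : W ⟶ Y) : W ⟶ Z := lift h y ≫ ev Y Z

/-- Uncurrying `Λ⁻¹ : C(X, Y ⇒ Z) → C(X × Y, Z)`. -/
def unlam {X Y Z : C} (g : X ⟶ Exp Y Z) : X ⊗ Y ⟶ Z := app (fst X Y ≫ g) (snd X Y)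

theorem comp_app {V W Y Z : C} (w : V ⟶ W) (h : W ⟶ Exp Y Z) (y : W ⟶ Y) :
    w ≫ app h y = app (w ≫ h) (w ≫ y) := by
  simp [app, comp_lift_assoc]

theorem comp_lam {V X Y Z : C} (w : V ⟶ X) (f : X ⊗ Y ⟶ Z) :
    w ≫ lam f = lam (lift (fst _ _ ≫ w) (snd _ _) ≫ f) := by
  unfold lam
  rw [← MonoidalClosed.curry_natural_left]
  congr 1
  rw [← assoc, ← assoc]
  congr 1
  ext <;> simp

theorem app_lam {X Y Z : C} (f : X ⊗ Y ⟶ Z) (y : X ⟶ Y) : app (lam f) y = lift (𝟙 X) y ≫ f := by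
  have h : lift (lam f) y = lift y (𝟙 X) ≫ (Y ◁ lam f) ≫ lift (snd _ _) (fst _ _) := by
    ext <;> simp
  have h2 : lift (snd (Exp Y Z) Y) (fst (Exp Y Z) Y) = lift (snd _ _) (fst _ _) := rfl
  unfold app ev
  rw [h]
  have h3 : lift (snd Y (Exp Y Z)) (fst Y (Exp Y Z)) ≫ lift (snd (Exp Y Z) Y) (fst (Exp Y Z) Y)
      = 𝟙 _ := by ext <;> simp
  simp only [assoc]
  rw [reassoc_of% h3]
  have h4 : Y ◁ lam f ≫ (ihom.ev Y).app Z = lift (snd Y X) (fst Y X) ≫ f := by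
    rw [← MonoidalClosed.uncurry_eq, lam, MonoidalClosed.uncurry_curry]
  rw [h4, ← assoc]
  congr 1
  ext <;> simp

theorem lam_unlam {X Y Z : C} (g : X ⟶ Exp Y Z) : lam (unlam g) = g := by
  unfold lam unlam app ev
  rw [MonoidalClosed.curry_eq_iff, MonoidalClosed.uncurry_eq, ← assoc, ← assoc]
  congr 1
  ext <;> simp

theorem lam_eta {X Y Z : C} (g : X ⟶ Exp Y Z) : lam (app (fst X Y ≫ g) (snd X Y)) = g :=
  lam_unlam g

theorem lam_eta_id {Y Z : C} : lam (app (fst (Exp Y Z) Y) (snd (Exp Y Z) Y)) = 𝟙 (Exp Y Z) := by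
  simpa using lam_eta (𝟙 (Exp Y Z))

theorem unlam_lam {X Y Z : C} (f : X ⊗ Y ⟶ Z) : unlam (lam f) = f := by
  unfold unlam
  rw [comp_lam, app_lam, ← assoc]
  have : lift (𝟙 (X ⊗ Y)) (snd X Y) ≫ lift (fst (X ⊗ Y) Y ≫ fst X Y) (snd (X ⊗ Y) Y) = 𝟙 _ := by
    ext <;> simp
  rw [this, id_comp]

theorem exp_ext {X Y Z : C} {g h : X ⟶ Exp Y Z}
    (e : app (fst X Y ≫ g) (snd X Y) = app (fst X Y ≫ h) (snd X Y)) : g = h := by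
  rw [← lam_eta g, e, lam_eta]

/-- Case analysis under a context: the composite of `[f, g] : X × Y₁ + X × Y₂ → Z` with the inverse
of the distributivity map `[id × ι₁, id × ι₂] : X × Y₁ + X × Y₂ → X × (Y₁ + Y₂)`. -/
def caseMor [HasBinaryCoproducts C] {X Y₁ Y₂ Z : C} (f : X ⊗ Y₁ ⟶ Z) (g : X ⊗ Y₂ ⟶ Z) :
    X ⊗ (Y₁ ⨿ Y₂) ⟶ Z :=
  app (snd _ _ ≫ coprod.desc (lam (lift (snd _ _) (fst _ _) ≫ f))
    (lam (lift (snd _ _) (fst _ _) ≫ g))) (fst _ _)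

theorem whiskerRight_ev {W Y Z : C} (h : W ⟶ Exp Y Z) : h ▷ Y ≫ ev Y Z = unlam h := by
  unfold unlam app
  congr 1
  ext <;> simp

theorem comp_lam' {V X Y Z : C} (w : V ⟶ X) (f : X ⊗ Y ⟶ Z) : w ≫ lam f = lam (w ▷ Y ≫ f) := by
  rw [comp_lam]
  congr 2
  ext <;> simp

theorem inl_caseMor [HasBinaryCoproducts C] {X Y₁ Y₂ Z : C} (f : X ⊗ Y₁ ⟶ Z) (g : X ⊗ Y₂ ⟶ Z) :
    X ◁ coprod.inl ≫ caseMor f g = f := by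
  unfold caseMor
  rw [comp_app, whiskerLeft_snd_assoc, coprod.inl_desc, whiskerLeft_fst, comp_lam, app_lam]
  simp only [← assoc]
  convert id_comp f using 2
  ext <;> simp

theorem inr_caseMor [HasBinaryCoproducts C] {X Y₁ Y₂ Z : C} (f : X ⊗ Y₁ ⟶ Z) (g : X ⊗ Y₂ ⟶ Z) :
    X ◁ coprod.inr ≫ caseMor f g = g := by
  unfold caseMor
  rw [comp_app, whiskerLeft_snd_assoc, coprod.inr_desc, whiskerLeft_fst, comp_lam, app_lam]
  simp only [← assoc]
  convert id_comp g using 2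
  ext <;> simp

/-- `(P' ⇒ ((Q' ⇒ Ω) ⇒ Ω)) ≅ ((P × (Q ⇒ Ω)) ⇒ Ω)`, by currying and by transport along `P ≅ P'` and
`Q ≅ Q'`: a function `m` is sent to `λ x k. m (a⁻¹ x, λ q. k (b q))`. -/
def arrowIso (Ω : C) {P P' Q Q' : C} (a : P ≅ P') (b : Q ≅ Q') :
    Exp (P ⊗ Exp Q Ω) Ω ≅ Exp P' (Exp (Exp Q' Ω) Ω) where
  hom := lam (lam (app (fst _ _ ≫ fst _ _)
    (lift (fst _ _ ≫ snd _ _ ≫ a.inv) (lam (app (fst _ _ ≫ snd _ _) (snd _ _ ≫ b.hom))))))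
  inv := lam (app (app (fst _ _) (snd _ _ ≫ fst _ _ ≫ a.hom))
    (lam (app (fst _ _ ≫ snd _ _ ≫ snd _ _) (snd _ _ ≫ b.inv))))
  hom_inv_id := by
    apply exp_ext
    simp [comp_app, comp_lam, app_lam, lam_eta, comp_lift]
  inv_hom_id := by
    apply exp_ext
    apply exp_ext
    simp [comp_app, comp_lam, app_lam, lam_eta, comp_lift]

end CCC

/-! ### Strong monads -/

section StrongMonads

variable (C : Type u) [Category.{v} C] [CartesianMonoidalCategory C]

/-- A strong monad: a monad with a natural strength `X × T Y → T (X × Y)` that is compatible with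
the unit, the multiplication, the left unitor and the associator. -/
structure StrongMonad extends CategoryTheory.Monad C where
  str : ∀ X Y : C, X ⊗ toFunctor.obj Y ⟶ toFunctor.obj (X ⊗ Y)
  str_naturality : ∀ {X X' Y Y' : C} (f : X ⟶ X') (g : Y ⟶ Y'),
    (f ⊗ₘ toFunctor.map g) ≫ str X' Y' = str X Y ≫ toFunctor.map (f ⊗ₘ g)
  str_unit : ∀ X Y : C, X ◁ η.app Y ≫ str X Y = η.app (X ⊗ Y)
  str_mul : ∀ X Y : C,
    X ◁ μ.app Y ≫ str X Y = str X (toFunctor.obj Y) ≫ toFunctor.map (str X Y) ≫ μ.app (X ⊗ Y)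
  str_leftUnitor : ∀ Y : C, str (𝟙_ C) Y ≫ toFunctor.map (λ_ Y).hom = (λ_ (toFunctor.obj Y)).hom
  str_associator : ∀ X Y Z : C, str (X ⊗ Y) Z ≫ toFunctor.map (α_ X Y Z).hom =
    (α_ X Y (toFunctor.obj Z)).hom ≫ X ◁ str Y Z ≫ str X (Y ⊗ Z)

variable {C}

/-- A morphism of strong monads: a morphism of monads that commutes with the strengths. -/
structure StrongMonadHom (S T : StrongMonad C) extends
    CategoryTheory.MonadHom S.toMonad T.toMonad where
  app_str : ∀ X Y : C, S.str X Y ≫ app (X ⊗ Y) = X ◁ app Y ≫ T.str X Y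

theorem StrongMonad.str_snd (T : StrongMonad C) (X Y : C) :
    T.str X Y ≫ T.map (snd X Y) = snd X (T.obj Y) := by
  have h : snd X Y = (toUnit X ⊗ₘ 𝟙 Y) ≫ (λ_ Y).hom := by simp [leftUnitor_hom]
  rw [h, Functor.map_comp, ← reassoc_of% (T.str_naturality (toUnit X) (𝟙 Y)), T.str_leftUnitor]
  simp [leftUnitor_hom]

theorem StrongMonad.lift_str_left (T : StrongMonad C) {V W X Y : C} (v : V ⟶ W) (w : W ⟶ X)
    (t : V ⟶ T.obj Y) :
    lift (v ≫ w) t ≫ T.str X Y = lift v t ≫ T.str W Y ≫ T.map (w ▷ Y) := by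
  have h := T.str_naturality w (𝟙 Y)
  rw [CategoryTheory.Functor.map_id, tensorHom_id, tensorHom_id] at h
  rw [← h, lift_whiskerRight_assoc]

theorem StrongMonad.lift_str_right (T : StrongMonad C) {V X Y Z : C} (v : V ⟶ X)
    (t : V ⟶ T.obj Y) (f : Y ⟶ Z) :
    lift v (t ≫ T.map f) ≫ T.str X Z = lift v t ≫ T.str X Y ≫ T.map (X ◁ f) := by
  have h := T.str_naturality (𝟙 X) f
  rw [id_tensorHom, id_tensorHom] at h
  rw [← h, lift_whiskerLeft_assoc]

theorem StrongMonad.lift_str_unit (T : StrongMonad C) {V X Y : C} (v : V ⟶ X) (t : V ⟶ Y) :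
    lift v (t ≫ T.η.app Y) ≫ T.str X Y = lift v t ≫ T.η.app (X ⊗ Y) := by
  rw [← T.str_unit, lift_whiskerLeft_assoc]

theorem StrongMonad.lift_str_mul (T : StrongMonad C) {V X Y : C} (v : V ⟶ X)
    (t : V ⟶ T.obj (T.obj Y)) :
    lift v (t ≫ T.μ.app Y) ≫ T.str X Y =
      lift v t ≫ T.str X (T.obj Y) ≫ T.map (T.str X Y) ≫ T.μ.app (X ⊗ Y) := by
  rw [← T.str_mul, lift_whiskerLeft_assoc]

theorem StrongMonad.lift_str_str (T : StrongMonad C) {V X Y Z : C} (v : V ⟶ X) (w : V ⟶ Y)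
    (t : V ⟶ T.obj Z) :
    lift v (lift w t ≫ T.str Y Z) ≫ T.str X (Y ⊗ Z) =
      lift (lift v w) t ≫ T.str (X ⊗ Y) Z ≫ T.map (α_ X Y Z).hom := by
  rw [T.str_associator, lift_lift_associator_hom_assoc, lift_whiskerLeft_assoc]

theorem associator_hom_eq (X Y Z : C) : (α_ X Y Z).hom =
    lift (fst _ _ ≫ fst _ _) (lift (fst _ _ ≫ snd _ _) (snd _ _)) := by
  ext <;> simp

end StrongMonads

section Closed

variable {C : Type u} [Category.{v} C] [CartesianMonoidalCategory C] [MonoidalClosed C]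

/-- The functor `Y ⇒ -` on a morphism. -/
def expMap (Y : C) {X X' : C} (f : X ⟶ X') : Exp Y X ⟶ Exp Y X' :=
  lam (ev _ _ ≫ f)

theorem lam_expMap {W Y X X' : C} (f : W ⊗ Y ⟶ X) (g : X ⟶ X') :
    lam f ≫ expMap Y g = lam (f ≫ g) := by
  unfold expMap
  rw [comp_lam', ← assoc, whiskerRight_ev, unlam_lam]

/-- `Λ((X × ev) ∘ α) : X × (D ⇒ Y) → (D ⇒ X × Y)`. -/
def expStr (D X Y : C) : X ⊗ Exp D Y ⟶ Exp D (X ⊗ Y) :=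
  lam ((α_ X (Exp D Y) D).hom ≫ X ◁ ev D Y)

/-- A `(D, Cr)`-ary algebraic operation for `T`: a natural family
`(D ⇒ T X) → (Cr ⇒ T X)` compatible with the strength and the multiplication. -/
structure AlgOp (T : StrongMonad C) (D Cr : C) where
  app : ∀ X : C, Exp D (T.obj X) ⟶ Exp Cr (T.obj X)
  naturality : ∀ {X Y : C} (f : X ⟶ Y),
    expMap D (T.map f) ≫ app Y = app X ≫ expMap Cr (T.map f)
  app_str : ∀ X Y : C, expStr D X (T.obj Y) ≫ expMap D (T.str X Y) ≫ app (X ⊗ Y) =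
    X ◁ app Y ≫ expStr Cr X (T.obj Y) ≫ expMap Cr (T.str X Y)
  app_mul : ∀ X : C, expMap D (T.μ.app X) ≫ app X = app (T.obj X) ≫ expMap Cr (T.μ.app X)

/-- The generic effect `Cr → T D` of an algebraic operation: the image of the unit. -/
def AlgOp.gef {T : StrongMonad C} {D Cr : C} (o : AlgOp T D Cr) : Cr ⟶ T.obj D :=
  LamCPS.app (toUnit Cr ≫ lam (snd _ _ ≫ T.η.app D) ≫ o.app D) (𝟙 Cr)

/-- Kleisli application with strength: `(D ⇒ T X) × T D → T X`. -/
def kleisliEv (T : StrongMonad C) (D X : C) : Exp D (T.obj X) ⊗ T.obj D ⟶ T.obj X :=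
  T.str _ _ ≫ T.map (ev D (T.obj X)) ≫ T.μ.app X

theorem kleisliEv_eq (T : StrongMonad C) {W D X : C} (h : W ⟶ Exp D (T.obj X)) :
    h ▷ T.obj D ≫ kleisliEv T D X = T.str _ _ ≫ T.map (unlam h) ≫ T.μ.app X := by
  have e := T.str_naturality h (𝟙 D)
  rw [CategoryTheory.Functor.map_id, tensorHom_id, tensorHom_id] at e
  unfold kleisliEv
  rw [reassoc_of% e, ← Functor.map_comp_assoc, whiskerRight_ev]

/-- The algebraic operation of a generic effect `e : Cr → T D`: it sends `f : D ⇒ T X` and `y : Cr`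
to the result of binding `e y` to `f`. -/
def AlgOp.ofGef {T : StrongMonad C} {D Cr : C} (e : Cr ⟶ T.obj D) : AlgOp T D Cr where
  app X := lam ((Exp D (T.obj X) ◁ e) ≫ kleisliEv T D X)
  naturality {X Y} f := by
    rw [comp_lam', lam_expMap, ← whisker_exchange_assoc, kleisliEv_eq, expMap, unlam_lam,
      Functor.map_comp, assoc, T.mu_naturality]
    simp [kleisliEv]
  app_str X Y := by
    rw [← assoc, comp_lam', ← whisker_exchange_assoc, kleisliEv_eq, expStr, lam_expMap, unlam_lam,
      expStr, lam_expMap, comp_lam']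
    have h := T.str_associator X (Exp D (T.obj Y)) D
    have h1 := T.str_naturality (𝟙 X) (ev D (T.obj Y))
    have h2 : (X ◁ lam (Exp D (T.obj Y) ◁ e ≫ kleisliEv T D Y)) ▷ Cr ≫
        (α_ X (Exp Cr (T.obj Y)) Cr).hom ≫ X ◁ ev Cr (T.obj Y) =
        (α_ X (Exp D (T.obj Y)) Cr).hom ≫ X ◁ (Exp D (T.obj Y) ◁ e ≫ kleisliEv T D Y) := by
      rw [associator_naturality_middle_assoc, ← whiskerLeft_comp, whiskerRight_ev, unlam_lam]
    rw [id_tensorHom, id_tensorHom] at h1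
    simp only [assoc, Functor.map_comp]
    rw [reassoc_of% h, ← reassoc_of% h1, reassoc_of% h2]
    simp [kleisliEv, MonoidalCategory.whiskerLeft_comp, T.str_mul]
  app_mul X := by
    rw [comp_lam', lam_expMap, ← whisker_exchange_assoc, kleisliEv_eq, expMap, unlam_lam,
      Functor.map_comp, assoc, T.assoc]
    simp [kleisliEv]

/-- The image of an algebraic operation under a strong monad morphism, through the correspondence
between algebraic operations and generic effects. -/
def AlgOp.map {S T : StrongMonad C} (φ : StrongMonadHom S T) {D Cr : C} (o : AlgOp S D Cr) :
    AlgOp T D Cr :=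
  AlgOp.ofGef (o.gef ≫ φ.app D)

/-- The continuation monad `K_Ω X = (X ⇒ Ω) ⇒ Ω`. -/
def contMonad (Ω : C) : StrongMonad C where
  obj X := Exp (Exp X Ω) Ω
  map f := lam (app (fst _ _) (lam (app (fst _ _ ≫ snd _ _) (snd _ _ ≫ f))))
  map_id X := by
    apply exp_ext; simp [comp_app, comp_lam, app_lam, lam_eta, comp_lift]
  map_comp f g := by
    apply exp_ext; simp [comp_app, comp_lam, app_lam, lam_eta, comp_lift]
  η := { app := fun X => lam (app (snd _ _) (fst _ _))
         naturality := fun X Y f => by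
          apply exp_ext; simp [comp_app, comp_lam, app_lam, lam_eta, comp_lift] }
  μ := { app := fun X => lam (app (fst _ _) (lam (app (snd _ _) (fst _ _ ≫ snd _ _))))
         naturality := fun X Y f => by
          apply exp_ext; simp [comp_app, comp_lam, app_lam, lam_eta, comp_lift] }
  assoc X := by
    apply exp_ext; simp [comp_app, comp_lam, app_lam, lam_eta, comp_lift]
  left_unit X := by
    apply exp_ext; simp [comp_app, comp_lam, app_lam, lam_eta, comp_lift]
  right_unit X := by
    apply exp_ext; simp [comp_app, comp_lam, app_lam, lam_eta, comp_lift]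
  str X Y := lam (app (fst _ _ ≫ snd _ _)
    (lam (app (fst _ _ ≫ snd _ _) (lift (fst _ _ ≫ fst _ _ ≫ fst _ _) (snd _ _)))))
  str_naturality f g := by
    apply exp_ext; simp [comp_app, comp_lam, app_lam, lam_eta, comp_lift]
  str_unit X Y := by
    apply exp_ext; simp [comp_app, comp_lam, app_lam, lam_eta, comp_lift]
  str_mul X Y := by
    apply exp_ext; simp [comp_app, comp_lam, app_lam, lam_eta, comp_lift]
  str_leftUnitor Y := by
    apply exp_ext; simp [comp_app, comp_lam, app_lam, lam_eta, comp_lift, leftUnitor_hom]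
  str_associator X Y Z := by
    apply exp_ext
    simp [comp_app, comp_lam, app_lam, lam_eta, comp_lift, associator_hom_eq]

/-- The map `(X ⇒ Ω) × T X → Ω`, `ν ∘ T ev ∘ st`. -/
def algEv (T : StrongMonad C) (ν : T.toMonad.Algebra) (X : C) : Exp X ν.A ⊗ T.obj X ⟶ ν.A :=
  T.str _ _ ≫ T.map (ev X ν.A) ≫ ν.a

theorem lift_algEv (T : StrongMonad C) (ν : T.toMonad.Algebra) {V W X : C} (v : V ⟶ W)
    (h : W ⊗ X ⟶ ν.A) (t : V ⟶ T.obj X) :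
    lift (v ≫ lam h) t ≫ algEv T ν X = lift v t ≫ T.str _ _ ≫ T.map h ≫ ν.a := by
  unfold algEv
  rw [← assoc, T.lift_str_left]
  simp only [assoc]
  rw [← Functor.map_comp_assoc, whiskerRight_ev, unlam_lam]

theorem lift_algEv' (T : StrongMonad C) (ν : T.toMonad.Algebra) {W X : C}
    (h : W ⊗ X ⟶ ν.A) (t : W ⟶ T.obj X) :
    lift (lam h) t ≫ algEv T ν X = lift (𝟙 W) t ≫ T.str _ _ ≫ T.map h ≫ ν.a := by
  simpa using lift_algEv T ν (𝟙 W) h t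

theorem lift_map_algEv (T : StrongMonad C) (ν : T.toMonad.Algebra) {V X Y : C}
    (h : V ⟶ Exp Y ν.A) (t : V ⟶ T.obj X) (f : X ⟶ Y) :
    lift h (t ≫ T.map f) ≫ algEv T ν Y =
      lift (𝟙 V) t ≫ T.str _ _ ≫ T.map (app (fst _ _ ≫ h) (snd _ _ ≫ f)) ≫ ν.a := by
  rw [← lam_eta h, lift_algEv', ← assoc, T.lift_str_right, lam_eta]
  simp only [assoc]
  rw [← Functor.map_comp_assoc]
  simp [comp_app]

/-- The strong monad morphism `φ^ν : T → K_Ω` of an Eilenberg-Moore algebra `ν : T Ω → Ω`,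
`φ^ν_X = Λ(ν ∘ T ev ∘ st ∘ β)`. -/
def contHom (T : StrongMonad C) (ν : T.toMonad.Algebra) : StrongMonadHom T (contMonad ν.A) where
  app X := lam (lift (snd _ _) (fst _ _) ≫ algEv T ν X)
  naturality X Y f := by
    apply exp_ext
    simp [contMonad, comp_app, comp_lam, app_lam, lam_eta, comp_lift, comp_lift_assoc]
    rw [lift_map_algEv, lift_algEv']
  app_η X := by
    apply exp_ext
    simp [contMonad, comp_app, comp_lam, app_lam, lam_eta, comp_lift, comp_lift_assoc]
    unfold algEv
    rw [← assoc, T.lift_str_unit, assoc, ← T.unit_naturality_assoc, ν.unit, comp_id]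
    rfl
  app_μ X := by
    apply exp_ext
    simp [contMonad, comp_app, comp_lam, app_lam, lam_eta, comp_lift, comp_lift_assoc]
    rw [lift_algEv', ← assoc (lift _ _) (T.str _ _), T.lift_str_right]
    conv_lhs => unfold algEv
    rw [← assoc (lift _ _) (T.str _ _), T.lift_str_mul,
      ← id_comp (snd (T.obj (T.obj X)) (Exp X ν.A)), ← assoc (lift _ _) (T.str _ _),
      T.lift_str_left]
    simp only [assoc]
    rw [← T.mu_naturality_assoc, ν.assoc]
    simp only [← Functor.map_comp_assoc, assoc]
    congr 4
    simp [comp_app, comp_lam, app_lam, lam_eta, comp_lift, comp_lift_assoc, algEv]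
    simp only [← assoc]
    congr 3
    ext <;> simp
  app_str X Y := by
    apply exp_ext
    simp [contMonad, comp_app, comp_lam, app_lam, lam_eta, comp_lift, comp_lift_assoc]
    have h : fst (X ⊗ T.obj Y) (Exp (X ⊗ Y) ν.A) ≫ T.str X Y = lift
      (fst (X ⊗ T.obj Y) (Exp (X ⊗ Y) ν.A) ≫ fst _ _)
      (fst (X ⊗ T.obj Y) (Exp (X ⊗ Y) ν.A) ≫ snd _ _) ≫ T.str X Y := by
      rw [← comp_lift_assoc]; simp
    rw [lift_algEv', h, algEv, ← assoc (lift _ _) (T.str _ _), T.lift_str_str,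
      ← id_comp (lift (snd _ _) _), ← assoc (lift _ _) (T.str _ _), ← assoc (lift _ _) (T.str _ _),
      T.lift_str_left]
    simp only [assoc]
    simp only [← Functor.map_comp_assoc, assoc]
    congr 4
    rw [app, ← assoc, ← assoc, associator_hom_eq]
    congr 1
    ext <;> simp

/-- The Eilenberg-Moore algebra on `Y ⇒ A` induced by one on `A`. -/
def expAlgebra (T : StrongMonad C) (α : T.toMonad.Algebra) (Y : C) : T.toMonad.Algebra where
  A := Exp Y α.A
  a := lam (lift (snd _ _) (fst _ _) ≫ T.str _ _ ≫
    T.map (lift (snd _ _) (fst _ _) ≫ ev Y α.A) ≫ α.a)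
  unit := by
    apply exp_ext
    simp only [Functor.id_obj, Functor.comp_obj]
    simp only [comp_app, comp_lam, app_lam, comp_lift_assoc, comp_lift, lift_fst_snd, lift_fst, lift_snd,
      lift_fst_assoc, lift_snd_assoc, id_comp, comp_id, assoc]
    rw [← assoc (lift _ _) (T.str _ _), T.lift_str_unit, assoc, ← T.unit_naturality_assoc, α.unit,
      comp_id, comp_lift_assoc, lift_fst, lift_snd]
    rfl
  assoc := by
    apply exp_ext
    simp only [Functor.id_obj, Functor.comp_obj]
    simp only [comp_app, comp_lam, app_lam, comp_lift_assoc, comp_lift, lift_fst_snd, lift_fst, lift_snd,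
      lift_fst_assoc, lift_snd_assoc, id_comp, comp_id, assoc]
    rw [← assoc (lift _ _) (T.str _ _), T.lift_str_mul]
    conv_rhs => rw [← assoc (lift _ _) (T.str _ _), T.lift_str_right]
    simp only [assoc]
    rw [← T.mu_naturality_assoc, α.assoc]
    simp only [← Functor.map_comp_assoc, assoc]
    congr 4
    have h : ∀ g : T.obj (Exp Y α.A) ⟶ Exp Y α.A, Y ◁ g ≫ lift (snd _ _) (fst _ _) ≫ ev Y α.A =
        lift (snd _ _) (fst _ _) ≫ unlam g := by
      intro g
      unfold unlam app
      simp only [← assoc]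
      congr 1
      ext <;> simp
    rw [h, unlam_lam, comp_lift_assoc, lift_fst, lift_snd, lift_fst_snd, id_comp]

end Closed

/-! ### `ωCPO`-enrichment, pseudo-lifting monads and fixed points -/

section Enriched

/-- An `ωCPO`-enriched bicartesian closed category: the homsets are `ω`-complete partial orders (not
necessarily with a least element), and composition, tupling, cotupling and currying are monotone and
preserve suprema of `ω`-chains. -/
class OmegaCPOEnriched (C : Type u) [Category.{v} C] [CartesianMonoidalCategory C]
    [MonoidalClosed C] [HasInitial C] [HasBinaryCoproducts C] where
  homCPO : ∀ X Y : C, OmegaCompletePartialOrder (X ⟶ Y)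
  comp_cont : ∀ X Y Z : C, OmegaCompletePartialOrder.ωScottContinuous
    (fun p : (X ⟶ Y) × (Y ⟶ Z) => p.1 ≫ p.2)
  lift_cont : ∀ X Y Z : C, OmegaCompletePartialOrder.ωScottContinuous
    (fun p : (X ⟶ Y) × (X ⟶ Z) => lift p.1 p.2)
  desc_cont : ∀ X Y Z : C, OmegaCompletePartialOrder.ωScottContinuous
    (fun p : (X ⟶ Z) × (Y ⟶ Z) => coprod.desc p.1 p.2)
  lam_cont : ∀ X Y Z : C, OmegaCompletePartialOrder.ωScottContinuous
    (fun f : X ⊗ Y ⟶ Z => lam f)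

attribute [reducible, instance] OmegaCPOEnriched.homCPO

variable {C : Type u} [Category.{v} C] [CartesianMonoidalCategory C] [MonoidalClosed C]
  [HasInitial C] [HasBinaryCoproducts C] [OmegaCPOEnriched C]

theorem comp_mono {X Y Z : C} {f f' : X ⟶ Y} {g g' : Y ⟶ Z} (hf : f ≤ f') (hg : g ≤ g') :
    f ≫ g ≤ f' ≫ g' :=
  (OmegaCPOEnriched.comp_cont X Y Z).monotone (show (f, g) ≤ (f', g') from ⟨hf, hg⟩)

theorem lift_mono {X Y Z : C} {f f' : X ⟶ Y} {g g' : X ⟶ Z} (hf : f ≤ f') (hg : g ≤ g') :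
    lift f g ≤ lift f' g' :=
  (OmegaCPOEnriched.lift_cont X Y Z).monotone (show (f, g) ≤ (f', g') from ⟨hf, hg⟩)

/-- The data that makes a strong monad `T` a pseudo-lifting one: a generic effect
`⊥ : 1 → T 0` such that `T ! ∘ ⊥ : 1 → T X` is the least morphism `1 → T X` for each `X`. -/
structure PseudoLifting (T : StrongMonad C) where
  bot : 𝟙_ C ⟶ T.obj (⊥_ C)
  bot_le : ∀ (X : C) (f : 𝟙_ C ⟶ T.obj X), bot ≫ T.map (initial.to X) ≤ f

/-- A strong monad morphism out of a pseudo-lifting strong monad makes its target one. -/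
def PseudoLifting.map {S T : StrongMonad C} (φ : StrongMonadHom S T) (P : PseudoLifting S) :
    PseudoLifting T where
  bot := P.bot ≫ φ.app (⊥_ C)
  bot_le X f := by
    have h := comp_mono (P.bot_le (T.obj X) (f ≫ S.η.app (T.obj X)))
      (le_refl (φ.app (T.obj X) ≫ T.μ.app X))
    have e1 : (f ≫ S.η.app (T.obj X)) ≫ φ.app (T.obj X) ≫ T.μ.app X = f := by
      rw [assoc, ← assoc (S.η.app _), φ.app_η, T.left_unit]
      exact comp_id f
    have e2 : initial.to (T.obj X) = initial.to X ≫ T.η.app X := initial.hom_ext _ _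
    rw [e1, assoc, ← assoc (S.map _), φ.naturality, e2, assoc, Functor.map_comp, assoc,
      T.right_unit] at h
    erw [comp_id] at h
    rwa [assoc]

/-- The morphism `X → A` that is constantly the least element of an Eilenberg-Moore algebra. -/
def PseudoLifting.botMor {T : StrongMonad C} (P : PseudoLifting T) (α : T.toMonad.Algebra) (X : C) :
    X ⟶ α.A :=
  toUnit X ≫ P.bot ≫ T.map (initial.to α.A) ≫ α.a

theorem PseudoLifting.botMor_le {T : StrongMonad C} (P : PseudoLifting T) (α : T.toMonad.Algebra)
    {X : C} (h : X ⟶ α.A) : P.botMor α X ≤ h := by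
  have h1 := comp_mono (P.bot_le (expAlgebra T α X).A
    (lam (snd (𝟙_ C) X ≫ h) ≫ T.η.app (expAlgebra T α X).A)) (le_refl (expAlgebra T α X).a)
  have e3 : (lam (snd (𝟙_ C) X ≫ h) ≫ T.η.app (expAlgebra T α X).A) ≫ (expAlgebra T α X).a =
      lam (snd (𝟙_ C) X ≫ h) := by
    refine (assoc _ _ _).trans ?_
    refine (congrArg (lam (snd (𝟙_ C) X ≫ h) ≫ ·) (expAlgebra T α X).unit).trans ?_
    exact comp_id _
  rw [e3] at h1
  have h2 := comp_mono (lift_mono (comp_mono (le_refl (toUnit X)) h1) (le_refl (𝟙 X)))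
    (le_refl (ev X α.A))
  have e1 : lift (toUnit X ≫ lam (snd (𝟙_ C) X ≫ h)) (𝟙 X) ≫ ev X α.A = h := by
    change app _ _ = _
    rw [comp_lam, app_lam]
    simp
  have e0 : X ◁ initial.to (Exp X α.A) ≫ lift (snd X (Exp X α.A)) (fst X (Exp X α.A)) ≫ ev X α.A =
      snd X (⊥_ C) ≫ initial.to α.A := by
    rw [← cancel_epi (zeroMul (A := X) (initialIsInitial (C := C))).inv]
    exact initial.hom_ext _ _
  have e2 : lift (toUnit X ≫ (P.bot ≫ T.map (initial.to (expAlgebra T α X).A)) ≫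
      (expAlgebra T α X).a) (𝟙 X) ≫ ev X α.A = P.botMor α X := by
    change app _ _ = _
    simp only [expAlgebra]
    rw [comp_lam, comp_lam, app_lam]
    simp only [comp_lift_assoc, lift_fst_assoc, lift_snd_assoc, lift_fst, lift_snd, assoc, id_comp]
    rw [← assoc (toUnit X), ← assoc (lift _ _) (T.str _ _), T.lift_str_right]
    simp only [assoc]
    rw [← Functor.map_comp_assoc, e0, Functor.map_comp, assoc, ← assoc (T.str _ _), T.str_snd,
      lift_snd_assoc, assoc]
    rfl
  exact (le_of_eq e2.symm).trans (h2.trans (le_of_eq e1))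

/-- The iterates of `f : X × A → A`, starting from the least morphism:
`f⁽⁰⁾ = ⊥` and `f⁽ⁿ⁺¹⁾ = f ∘ ⟨id, f⁽ⁿ⁾⟩`. -/
def PseudoLifting.iter {T : StrongMonad C} (P : PseudoLifting T) (α : T.toMonad.Algebra) {X : C}
    (f : X ⊗ α.A ⟶ α.A) : ℕ → (X ⟶ α.A)
  | 0 => P.botMor α X
  | n + 1 => lift (𝟙 X) (P.iter α f n) ≫ f

theorem PseudoLifting.iter_mono {T : StrongMonad C} (P : PseudoLifting T) (α : T.toMonad.Algebra)
    {X : C} (f : X ⊗ α.A ⟶ α.A) : Monotone (P.iter α f) := by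
  refine monotone_nat_of_le_succ fun n => ?_
  induction n with
  | zero => exact P.botMor_le α _
  | succ n ih => exact comp_mono (lift_mono le_rfl ih) le_rfl

/-- The parameterized uniform fixed-point operator `C(X × A, A) → C(X, A)` for an Eilenberg-Moore
algebra on `A`: `f† = sup_n f⁽ⁿ⁾`, i.e. `f†(x) = sup_n (f(x, -))ⁿ(⊥)`. For `X = 1` and the free algebra
`A = T Y` this is the uniform `T`-fixed-point operator `sup_n (fⁿ ∘ ⊥)`. -/
def PseudoLifting.fix {T : StrongMonad C} (P : PseudoLifting T) (α : T.toMonad.Algebra) {X : C}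
    (f : X ⊗ α.A ⟶ α.A) : X ⟶ α.A :=
  OmegaCompletePartialOrder.ωSup ⟨⟨P.iter α f, P.iter_mono α f⟩⟩

end Enriched

/-! ### Types and terms of the source and target languages -/

section Languages

/-- Ground types over a set `B` of base types. -/
inductive GTy (B : Type uB) : Type uB
  | base : B → GTy B
  | unit : GTy B
  | prod : GTy B → GTy B → GTy B
  | empty : GTy B
  | sum : GTy B → GTy B → GTy B

/-- Types of the `λ_c`-calculus. -/
inductive Ty (B : Type uB) : Type uB
  | base : B → Ty B
  | unit : Ty B
  | prod : Ty B → Ty B → Ty B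
  | empty : Ty B
  | sum : Ty B → Ty B → Ty B
  | arrow : Ty B → Ty B → Ty B

/-- Types of the target language: `ans` is the answer type `R`, and `pred ρ` is `ρ → R`. -/
inductive RTy (B : Type uB) : Type uB
  | ans : RTy B
  | base : B → RTy B
  | unit : RTy B
  | prod : RTy B → RTy B → RTy B
  | empty : RTy B
  | sum : RTy B → RTy B → RTy B
  | pred : RTy B → RTy B

/-- Ground types as types of the `λ_c`-calculus. -/
def GTy.toTy {B : Type uB} : GTy B → Ty B
  | .base b => .base b
  | .unit => .unit
  | .prod ρ τ => .prod ρ.toTy τ.toTy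
  | .empty => .empty
  | .sum ρ τ => .sum ρ.toTy τ.toTy

/-- Ground types as types of the target language. -/
def GTy.toRTy {B : Type uB} : GTy B → RTy B
  | .base b => .base b
  | .unit => .unit
  | .prod ρ τ => .prod ρ.toRTy τ.toRTy
  | .empty => .empty
  | .sum ρ τ => .sum ρ.toRTy τ.toRTy

/-- A `λ_c`-signature: base types `B`, effect-free constants `K`, algebraic operations `O`, with
their arities and coarities. -/
structure Signature where
  B : Type uB
  K : Type uK
  O : Type uO
  arK : K → GTy B
  carK : K → GTy B
  arO : O → GTy B
  carO : O → GTy B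

/-- Variables of type `ρ` in a context, as de Bruijn indices. The head of the list is the most
recently bound variable. -/
inductive Var {A : Type uB} : List A → A → Type uB
  | zero {Γ : List A} {ρ : A} : Var (ρ :: Γ) ρ
  | succ {Γ : List A} {ρ τ : A} : Var Γ ρ → Var (τ :: Γ) ρ

/-- Well-typed terms `Γ ⊢ M : ρ` of the `λ_c`-calculus with recursion. -/
inductive Tm (S : Signature.{uB, uK, uO}) : List (Ty S.B) → Ty S.B → Type (max uB uK uO)
  | var {Γ : List (Ty S.B)} {ρ : Ty S.B} : Var Γ ρ → Tm S Γ ρ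
  | const {Γ : List (Ty S.B)} (c : S.K) : Tm S Γ (S.arK c).toTy → Tm S Γ (S.carK c).toTy
  | op {Γ : List (Ty S.B)} (o : S.O) {ρ : Ty S.B} :
      Tm S Γ (.prod (.arrow (S.arO o).toTy ρ) (S.carO o).toTy) → Tm S Γ ρ
  | unit {Γ : List (Ty S.B)} : Tm S Γ .unit
  | pair {Γ : List (Ty S.B)} {ρ τ : Ty S.B} : Tm S Γ ρ → Tm S Γ τ → Tm S Γ (.prod ρ τ)
  | fst {Γ : List (Ty S.B)} {ρ τ : Ty S.B} : Tm S Γ (.prod ρ τ) → Tm S Γ ρ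
  | snd {Γ : List (Ty S.B)} {ρ τ : Ty S.B} : Tm S Γ (.prod ρ τ) → Tm S Γ τ
  | abort {Γ : List (Ty S.B)} {ρ : Ty S.B} : Tm S Γ .empty → Tm S Γ ρ
  | inl {Γ : List (Ty S.B)} {ρ τ : Ty S.B} : Tm S Γ ρ → Tm S Γ (.sum ρ τ)
  | inr {Γ : List (Ty S.B)} {ρ τ : Ty S.B} : Tm S Γ τ → Tm S Γ (.sum ρ τ)
  | case {Γ : List (Ty S.B)} {ρ₁ ρ₂ τ : Ty S.B} :
      Tm S Γ (.sum ρ₁ ρ₂) → Tm S (ρ₁ :: Γ) τ → Tm S (ρ₂ :: Γ) τ → Tm S Γ τ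
  | lam {Γ : List (Ty S.B)} {ρ τ : Ty S.B} : Tm S (ρ :: Γ) τ → Tm S Γ (.arrow ρ τ)
  | app {Γ : List (Ty S.B)} {ρ τ : Ty S.B} : Tm S Γ (.arrow ρ τ) → Tm S Γ ρ → Tm S Γ τ
  /-- `let rec f x = M in N`, with `f` bound before `x` in `M`. -/
  | letrec {Γ : List (Ty S.B)} {ρ τ σ : Ty S.B} :
      Tm S (ρ :: .arrow ρ τ :: Γ) τ → Tm S (.arrow ρ τ :: Γ) σ → Tm S Γ σ

/-- Well-typed terms `Γ ⊢ M : ρ` of the target language with fixed points. -/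
inductive RTm (S : Signature.{uB, uK, uO}) : List (RTy S.B) → RTy S.B → Type (max uB uK uO)
  | var {Γ : List (RTy S.B)} {ρ : RTy S.B} : Var Γ ρ → RTm S Γ ρ
  | const {Γ : List (RTy S.B)} (c : S.K) : RTm S Γ (S.arK c).toRTy → RTm S Γ (S.carK c).toRTy
  | op {Γ : List (RTy S.B)} (o : S.O) :
      RTm S Γ (.prod (.pred (S.arO o).toRTy) (S.carO o).toRTy) → RTm S Γ .ans
  | unit {Γ : List (RTy S.B)} : RTm S Γ .unit
  | pair {Γ : List (RTy S.B)} {ρ τ : RTy S.B} : RTm S Γ ρ → RTm S Γ τ → RTm S Γ (.prod ρ τ)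
  | fst {Γ : List (RTy S.B)} {ρ τ : RTy S.B} : RTm S Γ (.prod ρ τ) → RTm S Γ ρ
  | snd {Γ : List (RTy S.B)} {ρ τ : RTy S.B} : RTm S Γ (.prod ρ τ) → RTm S Γ τ
  | abort {Γ : List (RTy S.B)} : RTm S Γ .empty → RTm S Γ .ans
  | inl {Γ : List (RTy S.B)} {ρ τ : RTy S.B} : RTm S Γ ρ → RTm S Γ (.sum ρ τ)
  | inr {Γ : List (RTy S.B)} {ρ τ : RTy S.B} : RTm S Γ τ → RTm S Γ (.sum ρ τ)
  | case {Γ : List (RTy S.B)} {ρ₁ ρ₂ : RTy S.B} :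
      RTm S Γ (.sum ρ₁ ρ₂) → RTm S (ρ₁ :: Γ) .ans → RTm S (ρ₂ :: Γ) .ans → RTm S Γ .ans
  | lam {Γ : List (RTy S.B)} {ρ : RTy S.B} : RTm S (ρ :: Γ) .ans → RTm S Γ (.pred ρ)
  | app {Γ : List (RTy S.B)} {ρ : RTy S.B} : RTm S Γ (.pred ρ) → RTm S Γ ρ → RTm S Γ .ans
  /-- `let rec f x = M in N`, with `f` bound before `x` in `M`. -/
  | letrec {Γ : List (RTy S.B)} {ρ τ : RTy S.B} :
      RTm S (ρ :: .pred ρ :: Γ) .ans → RTm S (.pred ρ :: Γ) τ → RTm S Γ τ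

variable {S : Signature.{uB, uK, uO}}

/-- A renaming under a binder. -/
def liftRen {A : Type uB} {Γ Δ : List A} (r : ∀ τ, Var Γ τ → Var Δ τ) (σ : A) :
    ∀ τ, Var (σ :: Γ) τ → Var (σ :: Δ) τ
  | _, .zero => .zero
  | _, .succ x => .succ (r _ x)

/-- Renaming of variables in target terms. -/
def RTm.rename : ∀ {Γ Δ : List (RTy S.B)} {ρ : RTy S.B}, (∀ τ, Var Γ τ → Var Δ τ) →
    RTm S Γ ρ → RTm S Δ ρ
  | _, _, _, r, .var x => .var (r _ x)
  | _, _, _, r, .const c M => .const c (M.rename r)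
  | _, _, _, r, .op o M => .op o (M.rename r)
  | _, _, _, _, .unit => .unit
  | _, _, _, r, .pair M N => .pair (M.rename r) (N.rename r)
  | _, _, _, r, .fst M => .fst (M.rename r)
  | _, _, _, r, .snd M => .snd (M.rename r)
  | _, _, _, r, .abort M => .abort (M.rename r)
  | _, _, _, r, .inl M => .inl (M.rename r)
  | _, _, _, r, .inr M => .inr (M.rename r)
  | _, _, _, r, .case M N₁ N₂ =>
      .case (M.rename r) (N₁.rename (liftRen r _)) (N₂.rename (liftRen r _))
  | _, _, _, r, .lam M => .lam (M.rename (liftRen r _))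
  | _, _, _, r, .app M N => .app (M.rename r) (N.rename r)
  | _, _, _, r, .letrec M N =>
      .letrec (M.rename (liftRen (liftRen r _) _)) (N.rename (liftRen r _))

/-- Weakening by one variable. -/
def RTm.wk {Γ : List (RTy S.B)} {ρ : RTy S.B} (σ : RTy S.B) (M : RTm S Γ ρ) : RTm S (σ :: Γ) ρ :=
  M.rename fun _ => .succ

/-- A substitution under a binder. -/
def liftSub {Γ Δ : List (RTy S.B)} (s : ∀ τ, Var Γ τ → RTm S Δ τ) (σ : RTy S.B) :
    ∀ τ, Var (σ :: Γ) τ → RTm S (σ :: Δ) τ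
  | _, .zero => .var .zero
  | _, .succ x => (s _ x).wk σ

/-- Simultaneous capture-avoiding substitution in target terms. -/
def RTm.subst : ∀ {Γ Δ : List (RTy S.B)} {ρ : RTy S.B}, (∀ τ, Var Γ τ → RTm S Δ τ) →
    RTm S Γ ρ → RTm S Δ ρ
  | _, _, _, s, .var x => s _ x
  | _, _, _, s, .const c M => .const c (M.subst s)
  | _, _, _, s, .op o M => .op o (M.subst s)
  | _, _, _, _, .unit => .unit
  | _, _, _, s, .pair M N => .pair (M.subst s) (N.subst s)
  | _, _, _, s, .fst M => .fst (M.subst s)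
  | _, _, _, s, .snd M => .snd (M.subst s)
  | _, _, _, s, .abort M => .abort (M.subst s)
  | _, _, _, s, .inl M => .inl (M.subst s)
  | _, _, _, s, .inr M => .inr (M.subst s)
  | _, _, _, s, .case M N₁ N₂ =>
      .case (M.subst s) (N₁.subst (liftSub s _)) (N₂.subst (liftSub s _))
  | _, _, _, s, .lam M => .lam (M.subst (liftSub s _))
  | _, _, _, s, .app M N => .app (M.subst s) (N.subst s)
  | _, _, _, s, .letrec M N =>
      .letrec (M.subst (liftSub (liftSub s _) _)) (N.subst (liftSub s _))

/-- The substitution `[π₁ z / x, π₂ z / y]` that turns a term over `x, y` into one over a single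
variable `z` of product type. -/
def splitSub {Γ : List (RTy S.B)} {ρ τ : RTy S.B} :
    ∀ σ, Var (τ :: ρ :: Γ) σ → RTm S (.prod ρ τ :: Γ) σ
  | _, .zero => .snd (.var .zero)
  | _, .succ .zero => .fst (.var .zero)
  | _, .succ (.succ x) => .var (.succ x)

/-- The sugar `λ (x, y). M`, with `x` bound before `y` in `M`. -/
def RTm.lamPair {Γ : List (RTy S.B)} {ρ τ : RTy S.B} (M : RTm S (τ :: ρ :: Γ) .ans) :
    RTm S Γ (.pred (.prod ρ τ)) :=
  .lam (M.subst splitSub)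

/-- The sugar `let rec f (x, y) = M in N`, with `f`, `x`, `y` bound in this order in `M`. -/
def RTm.letrecPair {Γ : List (RTy S.B)} {ρ τ σ : RTy S.B}
    (M : RTm S (τ :: ρ :: .pred (.prod ρ τ) :: Γ) .ans) (N : RTm S (.pred (.prod ρ τ) :: Γ) σ) :
    RTm S Γ σ :=
  .letrec (M.subst splitSub) N

/-- Transport of a target term along an equality of types. -/
def RTm.castTy {Γ : List (RTy S.B)} {ρ τ : RTy S.B} (h : ρ = τ) (M : RTm S Γ ρ) : RTm S Γ τ :=
  h ▸ M

end Languages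

/-! ### The CPS transformation -/

section CPS

/-- The CPS transformation of types. -/
def cpsTy {B : Type uB} : Ty B → RTy B
  | .base b => .base b
  | .unit => .unit
  | .prod ρ τ => .prod (cpsTy ρ) (cpsTy τ)
  | .empty => .empty
  | .sum ρ τ => .sum (cpsTy ρ) (cpsTy τ)
  | .arrow ρ τ => .pred (.prod (cpsTy ρ) (.pred (cpsTy τ)))

/-- The CPS transformation of contexts. -/
abbrev cpsCtx {B : Type uB} (Γ : List (Ty B)) : List (RTy B) := Γ.map cpsTy

theorem cpsTy_toTy {B : Type uB} (g : GTy B) : cpsTy g.toTy = g.toRTy := by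
  induction g with
  | base b => rfl
  | unit => rfl
  | prod ρ τ h1 h2 => simp [GTy.toTy, GTy.toRTy, cpsTy, h1, h2]
  | empty => rfl
  | sum ρ τ h1 h2 => simp [GTy.toTy, GTy.toRTy, cpsTy, h1, h2]

/-- The CPS transformation of variables. -/
def cpsVar {B : Type uB} : ∀ {Γ : List (Ty B)} {ρ : Ty B}, Var Γ ρ → Var (cpsCtx Γ) (cpsTy ρ)
  | _, _, .zero => .zero
  | _, _, .succ x => .succ (cpsVar x)

variable {S : Signature.{uB, uK, uO}}

/-- The CPS transformation of terms, `Γ ⊢ M : ρ` to `Γ^CPS ⊢ M^CPS : (ρ^CPS → R) → R`. -/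
def cps : ∀ {Γ : List (Ty S.B)} {ρ : Ty S.B}, Tm S Γ ρ → RTm S (cpsCtx Γ) (.pred (.pred (cpsTy ρ)))
  -- `λ k. k x`
  | _, _, .var x => .lam (.app (.var .zero) ((RTm.var (cpsVar x)).wk _))
  -- `λ k. M (λ m. k (c m))`
  | _, _, .const c M =>
      .lam (.app ((cps M).wk _) (.lam (.app (.var (.succ .zero))
        ((RTm.const c ((RTm.var .zero).castTy (cpsTy_toTy (S.arK c)))).castTy
          (cpsTy_toTy (S.carK c)).symm))))
  -- `λ k. M (λ (m₁, m₂). o (λ x. m₁ (x, k), m₂))`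
  | _, _, .op o M =>
      .lam (.app ((cps M).wk _) (RTm.lamPair (.op o (.pair
        (.lam (.app (.var (.succ (.succ .zero)))
          (.pair ((RTm.var .zero).castTy (cpsTy_toTy (S.arO o)).symm)
            (.var (.succ (.succ (.succ .zero)))))))
        ((RTm.var .zero).castTy (cpsTy_toTy (S.carO o)))))))
  -- `λ k. k ()`
  | _, _, .unit => .lam (.app (.var .zero) .unit)
  -- `λ k. M₁ (λ m₁. M₂ (λ m₂. k (m₁, m₂)))`
  | _, _, .pair M₁ M₂ =>
      .lam (.app ((cps M₁).wk _) (.lam (.app (((cps M₂).wk _).wk _) (.lam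
        (.app (.var (.succ (.succ .zero))) (.pair (.var (.succ .zero)) (.var .zero)))))))
  -- `λ k. M (λ m. k (π_i m))`
  | _, _, .fst M => .lam (.app ((cps M).wk _) (.lam (.app (.var (.succ .zero)) (.fst (.var .zero)))))
  | _, _, .snd M => .lam (.app ((cps M).wk _) (.lam (.app (.var (.succ .zero)) (.snd (.var .zero)))))
  -- `λ k. M (λ m. δ(m))`
  | _, _, .abort M => .lam (.app ((cps M).wk _) (.lam (.abort (.var .zero))))
  -- `λ k. M (λ m. k (ι_i m))`
  | _, _, .inl M => .lam (.app ((cps M).wk _) (.lam (.app (.var (.succ .zero)) (.inl (.var .zero)))))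
  | _, _, .inr M => .lam (.app ((cps M).wk _) (.lam (.app (.var (.succ .zero)) (.inr (.var .zero)))))
  -- `λ k. M (λ m. δ(m, x₁. M₁ k, x₂. M₂ k))`
  | _, _, .case M M₁ M₂ =>
      .lam (.app ((cps M).wk _) (.lam (.case (.var .zero)
        (.app ((cps M₁).rename (liftRen (fun _ x => .succ (.succ x)) _)) (.var (.succ (.succ .zero))))
        (.app ((cps M₂).rename (liftRen (fun _ x => .succ (.succ x)) _))
          (.var (.succ (.succ .zero)))))))
  -- `λ k. k (λ (x, h). M h)`
  | _, _, .lam M =>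
      .lam (.app (.var .zero) (RTm.lamPair
        (.app ((cps M).rename (fun _ x => .succ (liftRen (fun _ => .succ) _ _ x))) (.var .zero))))
  -- `λ k. M (λ m. N (λ n. m (n, k)))`
  | _, _, .app M N =>
      .lam (.app ((cps M).wk _) (.lam (.app (((cps N).wk _).wk _) (.lam
        (.app (.var (.succ .zero)) (.pair (.var .zero) (.var (.succ (.succ .zero)))))))))
  -- `let rec f (x, k) = M k in N`
  | _, _, .letrec M N => RTm.letrecPair (.app ((cps M).wk _) (.var .zero)) (cps N)

end CPS

/-! ### Interpretations -/

section Semantics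

variable {C : Type u} [Category.{v} C] [CartesianMonoidalCategory C] [MonoidalClosed C]
  [HasInitial C] [HasBinaryCoproducts C]

/-- The interpretation of ground types. -/
def gInterp {B : Type uB} (A : B → C) : GTy B → C
  | .base b => A b
  | .unit => 𝟙_ C
  | .prod ρ τ => gInterp A ρ ⊗ gInterp A τ
  | .empty => ⊥_ C
  | .sum ρ τ => gInterp A ρ ⨿ gInterp A τ

/-- The interpretation of types of the `λ_c`-calculus, with `⟦ρ → τ⟧ = ⟦ρ⟧ ⇒ T ⟦τ⟧`. -/
def tyInterp {B : Type uB} (T : StrongMonad C) (A : B → C) : Ty B → C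
  | .base b => A b
  | .unit => 𝟙_ C
  | .prod ρ τ => tyInterp T A ρ ⊗ tyInterp T A τ
  | .empty => ⊥_ C
  | .sum ρ τ => tyInterp T A ρ ⨿ tyInterp T A τ
  | .arrow ρ τ => Exp (tyInterp T A ρ) (T.obj (tyInterp T A τ))

/-- The interpretation of types of the target language, where `R` is interpreted as `Ω`. -/
def rtyInterp {B : Type uB} (Ω : C) (A : B → C) : RTy B → C
  | .ans => Ω
  | .base b => A b
  | .unit => 𝟙_ C
  | .prod ρ τ => rtyInterp Ω A ρ ⊗ rtyInterp Ω A τ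
  | .empty => ⊥_ C
  | .sum ρ τ => rtyInterp Ω A ρ ⨿ rtyInterp Ω A τ
  | .pred ρ => Exp (rtyInterp Ω A ρ) Ω

theorem tyInterp_toTy {B : Type uB} (T : StrongMonad C) (A : B → C) (g : GTy B) :
    tyInterp T A g.toTy = gInterp A g := by
  induction g with
  | base b => rfl
  | unit => rfl
  | prod ρ τ h1 h2 => simp only [GTy.toTy, tyInterp, gInterp, h1, h2]
  | empty => rfl
  | sum ρ τ h1 h2 => simp only [GTy.toTy, tyInterp, gInterp, h1, h2]

theorem rtyInterp_toRTy {B : Type uB} (Ω : C) (A : B → C) (g : GTy B) :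
    rtyInterp Ω A g.toRTy = gInterp A g := by
  induction g with
  | base b => rfl
  | unit => rfl
  | prod ρ τ h1 h2 => simp only [GTy.toRTy, rtyInterp, gInterp, h1, h2]
  | empty => rfl
  | sum ρ τ h1 h2 => simp only [GTy.toRTy, rtyInterp, gInterp, h1, h2]

/-- The interpretation of contexts, given that of types. -/
def ctxInterp {A : Type uB} (I : A → C) : List A → C
  | [] => 𝟙_ C
  | ρ :: Γ => ctxInterp I Γ ⊗ I ρ

/-- The projection to a variable. -/
def varInterp {A : Type uB} (I : A → C) : ∀ {Γ : List A} {ρ : A}, Var Γ ρ → (ctxInterp I Γ ⟶ I ρ)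
  | _, _, .zero => snd _ _
  | _, _, .succ x => fst _ _ ≫ varInterp I x

variable [OmegaCPOEnriched C]

variable (C) in
/-- An `ωCPO`-enriched `λ_c(Σ)`-structure on the `ωCPO`-enriched bicartesian closed category `C`:
a pseudo-lifting strong monad and interpretations of the base types, the effect-free constants and
the algebraic operations. -/
structure LamStructure (S : Signature.{uB, uK, uO}) where
  T : StrongMonad C
  pl : PseudoLifting T
  A : S.B → C
  aK : ∀ c : S.K, gInterp A (S.arK c) ⟶ gInterp A (S.carK c)
  aO : ∀ o : S.O, AlgOp T (gInterp A (S.arO o)) (gInterp A (S.carO o))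

variable {S : Signature.{uB, uK, uO}}

/-- The structure `φ 𝒜` induced by a strong monad morphism `φ`. -/
def LamStructure.map (𝒜 : LamStructure C S) {T' : StrongMonad C} (φ : StrongMonadHom 𝒜.T T') :
    LamStructure C S where
  T := T'
  pl := 𝒜.pl.map φ
  A := 𝒜.A
  aK := 𝒜.aK
  aO o := (𝒜.aO o).map φ

/-- The interpretation `𝒜⟦ρ⟧` of source types. -/
abbrev LamStructure.ty (𝒜 : LamStructure C S) (ρ : Ty S.B) : C := tyInterp 𝒜.T 𝒜.A ρ

/-- The interpretation `𝒜⟦Γ⟧` of source contexts. -/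
abbrev LamStructure.ctx (𝒜 : LamStructure C S) (Γ : List (Ty S.B)) : C := ctxInterp 𝒜.ty Γ

/-- The interpretation `𝒜^ν⟦ρ⟧` of target types. -/
abbrev LamStructure.rty (𝒜 : LamStructure C S) (ν : 𝒜.T.toMonad.Algebra) (ρ : RTy S.B) : C :=
  rtyInterp ν.A 𝒜.A ρ

/-- The interpretation `𝒜^ν⟦Γ⟧` of target contexts. -/
abbrev LamStructure.rctx (𝒜 : LamStructure C S) (ν : 𝒜.T.toMonad.Algebra) (Γ : List (RTy S.B)) :
    C :=
  ctxInterp (𝒜.rty ν) Γ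

/-- Sequencing of two computations, the left one first:
`μ ∘ T st ∘ T β ∘ st ∘ β : T X × T Y → T (X × Y)`. -/
def StrongMonad.seq (T : StrongMonad C) (X Y : C) : T.obj X ⊗ T.obj Y ⟶ T.obj (X ⊗ Y) :=
  lift (snd _ _) (fst _ _) ≫ T.str (T.obj Y) X ≫ T.map (lift (snd _ _) (fst _ _)) ≫
    T.map (T.str X Y) ≫ T.μ.app (X ⊗ Y)

/-- The interpretation `𝒜⟦M⟧ : 𝒜⟦Γ⟧ → T 𝒜⟦ρ⟧` of source terms. -/
def LamStructure.interp (𝒜 : LamStructure C S) :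
    ∀ {Γ : List (Ty S.B)} {ρ : Ty S.B}, Tm S Γ ρ → (𝒜.ctx Γ ⟶ 𝒜.T.obj (𝒜.ty ρ))
  | _, _, .var x => varInterp 𝒜.ty x ≫ 𝒜.T.η.app _
  | _, _, .const c M => 𝒜.interp M ≫ 𝒜.T.map
      (eqToHom (tyInterp_toTy 𝒜.T 𝒜.A (S.arK c)) ≫ 𝒜.aK c ≫
        eqToHom (tyInterp_toTy 𝒜.T 𝒜.A (S.carK c)).symm)
  | _, _, .op (ρ := ρ) o M => 𝒜.interp M ≫ 𝒜.T.map
      (eqToHom (show 𝒜.ty (.prod (.arrow (S.arO o).toTy ρ) (S.carO o).toTy) =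
          Exp (gInterp 𝒜.A (S.arO o)) (𝒜.T.obj (𝒜.ty ρ)) ⊗ gInterp 𝒜.A (S.carO o) by
        simp only [tyInterp, tyInterp_toTy]) ≫ unlam ((𝒜.aO o).app (𝒜.ty ρ))) ≫ 𝒜.T.μ.app _
  | _, _, .unit => toUnit _ ≫ 𝒜.T.η.app (𝟙_ C)
  | _, _, .pair M₁ M₂ => lift (𝒜.interp M₁) (𝒜.interp M₂) ≫ 𝒜.T.seq _ _
  | _, _, .fst M => 𝒜.interp M ≫ 𝒜.T.map (fst _ _)
  | _, _, .snd M => 𝒜.interp M ≫ 𝒜.T.map (snd _ _)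
  | _, _, .abort M => 𝒜.interp M ≫ 𝒜.T.map (initial.to _)
  | _, _, .inl M => 𝒜.interp M ≫ 𝒜.T.map coprod.inl
  | _, _, .inr M => 𝒜.interp M ≫ 𝒜.T.map coprod.inr
  | _, _, .case M M₁ M₂ => lift (𝟙 _) (𝒜.interp M) ≫ 𝒜.T.str _ _ ≫
      𝒜.T.map (caseMor (𝒜.interp M₁) (𝒜.interp M₂)) ≫ 𝒜.T.μ.app _
  | _, _, .lam M => LamCPS.lam (𝒜.interp M) ≫ 𝒜.T.η.app _
  | _, _, .app M N => lift (𝒜.interp M) (𝒜.interp N) ≫ 𝒜.T.seq _ _ ≫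
      𝒜.T.map (ev _ _) ≫ 𝒜.T.μ.app _
  | _, _, .letrec (ρ := ρ) (τ := τ) M N =>
      lift (𝟙 _) (𝒜.pl.fix (expAlgebra 𝒜.T (𝒜.T.toMonad.free.obj (𝒜.ty τ)) (𝒜.ty ρ))
        (LamCPS.lam (𝒜.interp M))) ≫ 𝒜.interp N

/-- The interpretation `𝒜^ν⟦M⟧ : 𝒜^ν⟦Γ⟧ → 𝒜^ν⟦ρ⟧` of target terms. -/
def LamStructure.rinterp (𝒜 : LamStructure C S) (ν : 𝒜.T.toMonad.Algebra) :
    ∀ {Γ : List (RTy S.B)} {ρ : RTy S.B}, RTm S Γ ρ → (𝒜.rctx ν Γ ⟶ 𝒜.rty ν ρ)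
  | _, _, .var x => varInterp (𝒜.rty ν) x
  | _, _, .const c M => 𝒜.rinterp ν M ≫ eqToHom (rtyInterp_toRTy ν.A 𝒜.A (S.arK c)) ≫ 𝒜.aK c ≫
      eqToHom (rtyInterp_toRTy ν.A 𝒜.A (S.carK c)).symm
  | _, _, .op o M => 𝒜.rinterp ν M ≫
      eqToHom (show 𝒜.rty ν (.prod (.pred (S.arO o).toRTy) (S.carO o).toRTy) =
          Exp (gInterp 𝒜.A (S.arO o)) ν.A ⊗ gInterp 𝒜.A (S.carO o) by
        simp only [rtyInterp, rtyInterp_toRTy]) ≫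
      (_ ◁ (𝒜.aO o).gef) ≫ 𝒜.T.str _ _ ≫ 𝒜.T.map (ev _ _) ≫ ν.a
  | _, _, .unit => toUnit _
  | _, _, .pair M N => lift (𝒜.rinterp ν M) (𝒜.rinterp ν N)
  | _, _, .fst M => 𝒜.rinterp ν M ≫ fst _ _
  | _, _, .snd M => 𝒜.rinterp ν M ≫ snd _ _
  | _, _, .abort M => 𝒜.rinterp ν M ≫ initial.to _
  | _, _, .inl M => 𝒜.rinterp ν M ≫ coprod.inl
  | _, _, .inr M => 𝒜.rinterp ν M ≫ coprod.inr
  | _, _, .case M M₁ M₂ =>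
      lift (𝟙 _) (𝒜.rinterp ν M) ≫ caseMor (𝒜.rinterp ν M₁) (𝒜.rinterp ν M₂)
  | _, _, .lam M => LamCPS.lam (𝒜.rinterp ν M)
  | _, _, .app M N => LamCPS.app (𝒜.rinterp ν M) (𝒜.rinterp ν N)
  | _, _, .letrec (ρ := ρ) M N =>
      lift (𝟙 _) (𝒜.pl.fix (expAlgebra 𝒜.T ν (𝒜.rty ν ρ)) (LamCPS.lam (𝒜.rinterp ν M))) ≫
        𝒜.rinterp ν N

/-- The structure `φ^ν 𝒜`, whose monad is the continuation monad `K_Ω`. -/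
abbrev LamStructure.cont (𝒜 : LamStructure C S) (ν : 𝒜.T.toMonad.Algebra) : LamStructure C S :=
  𝒜.map (contHom 𝒜.T ν)

/-- The canonical isomorphism `ψ_ρ : 𝒜^ν⟦ρ^CPS⟧ ≅ (φ^ν 𝒜)⟦ρ⟧`, by recursion on `ρ`. -/
def LamStructure.psi (𝒜 : LamStructure C S) (ν : 𝒜.T.toMonad.Algebra) :
    ∀ ρ : Ty S.B, 𝒜.rty ν (cpsTy ρ) ≅ (𝒜.cont ν).ty ρ
  | .base b => Iso.refl (𝒜.A b)
  | .unit => Iso.refl (𝟙_ C)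
  | .prod ρ τ => 𝒜.psi ν ρ ⊗ᵢ 𝒜.psi ν τ
  | .empty => Iso.refl (⊥_ C)
  | .sum ρ τ => coprod.mapIso (𝒜.psi ν ρ) (𝒜.psi ν τ)
  | .arrow ρ τ => arrowIso ν.A (𝒜.psi ν ρ) (𝒜.psi ν τ)

/-- The extension of `ψ` to contexts. -/
def LamStructure.psiCtx (𝒜 : LamStructure C S) (ν : 𝒜.T.toMonad.Algebra) :
    ∀ Γ : List (Ty S.B), 𝒜.rctx ν (cpsCtx Γ) ≅ (𝒜.cont ν).ctx Γ
  | [] => Iso.refl (𝟙_ C)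
  | ρ :: Γ => 𝒜.psiCtx ν Γ ⊗ᵢ 𝒜.psi ν ρ

/-- For a ground type, the two interpretations related by `ψ` are the same object. -/
theorem LamStructure.rty_cpsTy_toTy (𝒜 : LamStructure C S) (ν : 𝒜.T.toMonad.Algebra) (g : GTy S.B) :
    𝒜.rty ν (cpsTy g.toTy) = (𝒜.cont ν).ty g.toTy := by
  rw [LamStructure.rty, cpsTy_toTy, rtyInterp_toRTy, LamStructure.ty, tyInterp_toTy]
  rfl

end Semantics

end

end LamCPS

/-!
The equation is proved by induction on the source term `M`. Write `w` for `ψ_Γ` and suppose that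
the equation is known for the immediate subterms of `M`.

The target term `cps M` is built from the images of the subterms by weakening, by the renamings
under binders, and by the substitution `splitSub` hidden in the sugar `λ (x, y). _`. Renamings and
substitutions are interpreted by precomposition (`rinterp_rename`, `rinterp_subst`), so that
`𝒜.rinterp ν (cps M)` becomes an expression in `lam`, `app`, `lift` and the interpretations of the
images of the subterms. On the other side the interpretation of `M` is an expression in the unit,
multiplication and strength of the continuation monad. For each term former other than `let rec`,
that these two expressions agree up to the isomorphisms `ψ` is an identity that holds in every
cartesian closed category, for arbitrary morphisms in the place of the subterms: `cps_unit_eq`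
(variables, `()` and, with `lam_arrowIso_hom`, abstractions), `cps_map_eq` (constants, projections
and injections), `cps_pair_eq`, `cps_app_eq`, `cps_op_eq`, `cps_case_eq` and `cps_abort_eq`. Both
sides are maps into an exponential; evaluated at a generic continuation they agree by
`βη`-rewriting and, for case analyses, because `X ⊗ -` preserves coproducts.

Operations use that `φ^ν` sends a generic effect `g` to `e ↦ λ j. (ν ∘ T ev ∘ st) (j, g e)`. The
morphism `ν ∘ T ev ∘ st` is the `A` of `cps_op_eq`.

For `let rec`, the two fixed points are suprema of iterates of morphisms that correspond to each
other under `w` and the isomorphism `arrowIso` (`PseudoLifting.fix_comp_iso`). The iterations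
start at corresponding elements, since each is the least morphism into its carrier and composition
with an isomorphism preserves and reflects the order; the suprema then correspond because
composition is continuous.

At a ground type, `ψ` is built from identities by products and coproducts. Since `⟦ρ^CPS⟧` and
`⟦ρ⟧` are equal objects but not by definition, it is an `eqToHom` (`psi_toTy_hom`).

The interpretations of types are recursive functions, so that e.g. `⟦ρ × τ⟧` is a product only
after unfolding. Equations between interpretations are therefore mostly chained with `Eq.trans`
and `congrArg`, which work up to unfolding, and not by rewriting.
-/

namespace LamCPS

/-! ### Transport of fixed points -/

section Fix

variable {C : Type u} [Category.{v} C] [CartesianMonoidalCategory C] [MonoidalClosed C]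
  [HasInitial C] [HasBinaryCoproducts C] [OmegaCPOEnriched C]

theorem comp_ωSup {X Y Z : C} (w : X ⟶ Y) (c : OmegaCompletePartialOrder.Chain (Y ⟶ Z)) :
    w ≫ OmegaCompletePartialOrder.ωSup c = OmegaCompletePartialOrder.ωSup
      (c.map ⟨fun f => w ≫ f, fun _ _ h => comp_mono le_rfl h⟩) :=
  ((OmegaCPOEnriched.comp_cont X Y Z).comp
    (Prod.ωScottContinuous.prodMk
      OmegaCompletePartialOrder.ωScottContinuous.const
      OmegaCompletePartialOrder.ωScottContinuous.id)).map_ωSup c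

theorem ωSup_comp {X Y Z : C} (c : OmegaCompletePartialOrder.Chain (X ⟶ Y)) (g : Y ⟶ Z) :
    OmegaCompletePartialOrder.ωSup c ≫ g = OmegaCompletePartialOrder.ωSup
      (c.map ⟨fun f => f ≫ g, fun _ _ h => comp_mono h le_rfl⟩) :=
  ((OmegaCPOEnriched.comp_cont X Y Z).comp
    (Prod.ωScottContinuous.prodMk
      OmegaCompletePartialOrder.ωScottContinuous.id
      OmegaCompletePartialOrder.ωScottContinuous.const)).map_ωSup c

variable {T T' : StrongMonad C}

theorem PseudoLifting.comp_botMor (P : PseudoLifting T) (α : T.toMonad.Algebra) {X X' : C}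
    (w : X ⟶ X') : w ≫ P.botMor α X' = P.botMor α X := by
  unfold PseudoLifting.botMor
  rw [← assoc, comp_toUnit]

/-- Least morphisms into isomorphic algebra carriers agree, even when the algebras are for different
monads: both sides are least, because composition with an isomorphism is an order isomorphism. -/
theorem PseudoLifting.botMor_comp_iso (P : PseudoLifting T) (P' : PseudoLifting T')
    (α : T.toMonad.Algebra) (α' : T'.toMonad.Algebra) (e : α.A ≅ α'.A) (X : C) :
    P.botMor α X ≫ e.hom = P'.botMor α' X := by
  refine le_antisymm ?_ (P'.botMor_le α' _)
  have h := comp_mono (P.botMor_le α (P'.botMor α' X ≫ e.inv)) (le_refl e.hom)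
  simpa using h

/-- Fixed points are transported along an isomorphism of the carriers and a change of parameters. -/
theorem PseudoLifting.fix_comp_iso (P : PseudoLifting T) (P' : PseudoLifting T')
    (α : T.toMonad.Algebra) (α' : T'.toMonad.Algebra) (e : α.A ≅ α'.A) {X X' : C} (w : X ⟶ X')
    (f : X ⊗ α.A ⟶ α.A) (f' : X' ⊗ α'.A ⟶ α'.A) (h : f ≫ e.hom = (w ⊗ₘ e.hom) ≫ f') :
    P.fix α f ≫ e.hom = w ≫ P'.fix α' f' := by
  unfold PseudoLifting.fix
  rw [ωSup_comp, comp_ωSup]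
  congr 1
  refine OmegaCompletePartialOrder.Chain.ext (funext fun n => ?_)
  change P.iter α f n ≫ e.hom = w ≫ P'.iter α' f' n
  induction n with
  | zero =>
    change P.botMor α X ≫ e.hom = w ≫ P'.botMor α' X'
    rw [P.botMor_comp_iso P', P'.comp_botMor]
  | succ n ih =>
    change (lift (𝟙 X) (P.iter α f n) ≫ f) ≫ e.hom = w ≫ lift (𝟙 X') (P'.iter α' f' n) ≫ f'
    rw [assoc, h, ← assoc, lift_map, ih, comp_lift_assoc, id_comp, comp_id]

theorem PseudoLifting.comp_fix (P : PseudoLifting T) (α : T.toMonad.Algebra) {X X' : C}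
    (w : X ⟶ X') (f : X' ⊗ α.A ⟶ α.A) : w ≫ P.fix α f = P.fix α (w ▷ α.A ≫ f) := by
  have := P.fix_comp_iso P α α (Iso.refl _) w (w ▷ α.A ≫ f) f (by simp)
  simpa using this.symm

/-- The interpretation of `let rec` is stable under a change of context `w`. -/
theorem PseudoLifting.lift_comp_fix (P : PseudoLifting T) (α : T.toMonad.Algebra) {X X' Z : C}
    (w : X ⟶ X') (f : X' ⊗ α.A ⟶ α.A) (g : X' ⊗ α.A ⟶ Z) :
    lift (𝟙 X) (P.fix α (w ▷ α.A ≫ f)) ≫ w ▷ α.A ≫ g = w ≫ lift (𝟙 X') (P.fix α f) ≫ g := by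
  rw [← P.comp_fix, lift_whiskerRight_assoc, comp_lift_assoc, id_comp, comp_id]

/-- `PseudoLifting.lift_comp_fix` for the algebra on an exponential, with the body uncurried as in
the clause of `let rec`. -/
theorem PseudoLifting.lift_comp_fix_lam (P : PseudoLifting T) (α : T.toMonad.Algebra) {X X' Y Z : C}
    (w : X ⟶ X') (f : (X' ⊗ Exp Y α.A) ⊗ Y ⟶ α.A) (g : X' ⊗ Exp Y α.A ⟶ Z) :
    lift (𝟙 X) (P.fix (expAlgebra T α Y) (lam (w ▷ Exp Y α.A ▷ Y ≫ f))) ≫ w ▷ Exp Y α.A ≫ g =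
      w ≫ lift (𝟙 X') (P.fix (expAlgebra T α Y) (lam f)) ≫ g :=
  (congrArg (fun t => lift (𝟙 X) (P.fix (expAlgebra T α Y) t) ≫ w ▷ Exp Y α.A ≫ g)
    (comp_lam' _ _).symm).trans (P.lift_comp_fix (expAlgebra T α Y) w (lam f) g)

/-- The interpretations of `let rec` correspond to each other as soon as those of its body `f` and
of its continuation `g` do, where `e` compares the two types of the recursive function. -/
theorem PseudoLifting.comp_lift_fix (P : PseudoLifting T) (P' : PseudoLifting T')
    (α : T.toMonad.Algebra) (α' : T'.toMonad.Algebra) (e : α.A ≅ α'.A) {X X' Z Z' : C} {w : X ⟶ X'}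
    {f : X ⊗ α.A ⟶ α.A} {f' : X' ⊗ α'.A ⟶ α'.A} {g : X ⊗ α.A ⟶ Z} {g' : X' ⊗ α'.A ⟶ Z'} {k : Z ⟶ Z'}
    (hf : (w ⊗ₘ e.hom) ≫ f' = f ≫ e.hom) (hg : (w ⊗ₘ e.hom) ≫ g' = g ≫ k) :
    w ≫ lift (𝟙 X') (P'.fix α' f') ≫ g' = (lift (𝟙 X) (P.fix α f) ≫ g) ≫ k := by
  rw [assoc, ← hg, lift_map_assoc, P.fix_comp_iso P' α α' e w f f' hf.symm, comp_lift_assoc,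
    id_comp, comp_id]

end Fix

/-! ### Renaming and substitution -/

section Substitution

variable {C : Type u} [Category.{v} C] [CartesianMonoidalCategory C]

theorem whiskerRight_eq_lift {W X : C} (w : W ⟶ X) (Y : C) :
    w ▷ Y = lift (fst W Y ≫ w) (snd W Y) := by
  ext <;> simp

/-- If `w` realises the renaming `r`, then `w ▷ I σ` realises `r` lifted under a binder. -/
theorem varInterp_liftRen {A : Type uB} (I : A → C) {Γ Δ : List A} (r : ∀ τ, Var Γ τ → Var Δ τ)
    (w : ctxInterp I Δ ⟶ ctxInterp I Γ)
    (h : ∀ τ (x : Var Γ τ), varInterp I (r τ x) = w ≫ varInterp I x) (σ : A) :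
    ∀ τ (x : Var (σ :: Γ) τ), varInterp I (liftRen r σ τ x) = w ▷ I σ ≫ varInterp I x
  | _, .zero => (whiskerRight_snd _ _).symm
  | _, .succ x => by
    change fst _ _ ≫ varInterp I (r _ x) = w ▷ I σ ≫ fst _ _ ≫ varInterp I x
    rw [h, whiskerRight_fst_assoc]

variable [MonoidalClosed C] [HasBinaryCoproducts C]

/-- Case analysis is natural in its context. -/
theorem comp_caseMor {W X Y₁ Y₂ Z : C} (w : W ⟶ X) (f : X ⊗ Y₁ ⟶ Z) (g : X ⊗ Y₂ ⟶ Z) :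
    w ▷ (Y₁ ⨿ Y₂) ≫ caseMor f g = caseMor (w ▷ Y₁ ≫ f) (w ▷ Y₂ ≫ g) := by
  unfold caseMor
  rw [comp_app, whiskerRight_snd_assoc, whiskerRight_fst]
  -- `caseMor` copairs maps into `Exp X Z`; the change of context acts there by precomposition with
  -- `w`, a single map that can be pulled out of the copairing.
  have key : ∀ {Y : C} (f : X ⊗ Y ⟶ Z),
      lam (lift (snd _ _) (fst _ _) ≫ w ▷ Y ≫ f) =
        lam (lift (snd _ _) (fst _ _) ≫ f) ≫ lam (app (fst _ _) (snd _ _ ≫ w)) := by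
    intro Y f
    simp [comp_app, comp_lam, app_lam, comp_lift_assoc]
  rw [key, key, ← coprod.desc_comp, ← assoc, comp_lam, app_lam]
  simp [comp_app]

theorem lift_comp_caseMor {W X Y₁ Y₂ Z : C} (w : W ⟶ X) (m : X ⟶ Y₁ ⨿ Y₂) (f : X ⊗ Y₁ ⟶ Z)
    (g : X ⊗ Y₂ ⟶ Z) : lift (𝟙 W) (w ≫ m) ≫ caseMor (w ▷ Y₁ ≫ f) (w ▷ Y₂ ≫ g) =
      w ≫ lift (𝟙 X) m ≫ caseMor f g := by
  rw [← comp_caseMor, lift_whiskerRight_assoc, comp_lift_assoc, id_comp, comp_id]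

variable [HasInitial C] [OmegaCPOEnriched C] {S : Signature.{uB, uK, uO}} (𝒜 : LamStructure C S)
  (ν : 𝒜.T.toMonad.Algebra)

/-- Renaming is interpreted by precomposition with any `w` that realises it on variables. -/
theorem LamStructure.rinterp_rename {Γ Δ : List (RTy S.B)} {ρ : RTy S.B} (M : RTm S Γ ρ)
    (r : ∀ τ, Var Γ τ → Var Δ τ) (w : 𝒜.rctx ν Δ ⟶ 𝒜.rctx ν Γ)
    (h : ∀ τ (x : Var Γ τ), varInterp (𝒜.rty ν) (r τ x) = w ≫ varInterp (𝒜.rty ν) x) :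
    𝒜.rinterp ν (M.rename r) = w ≫ 𝒜.rinterp ν M := by
  induction M generalizing Δ with
  | var x => exact h _ x
  | const c M ih => simp only [RTm.rename, rinterp, ih r w h, assoc]
  | op o M ih => simp only [RTm.rename, rinterp, ih r w h, assoc]
  | unit => exact (comp_toUnit _).symm
  | pair M N ihM ihN =>
    exact (congrArg₂ lift (ihM r w h) (ihN r w h)).trans (comp_lift _ _ _).symm
  | fst M ih => exact (congrArg (· ≫ _) (ih r w h)).trans (assoc _ _ _)
  | snd M ih => exact (congrArg (· ≫ _) (ih r w h)).trans (assoc _ _ _)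
  | abort M ih => exact (congrArg (· ≫ _) (ih r w h)).trans (assoc _ _ _)
  | inl M ih => exact (congrArg (· ≫ _) (ih r w h)).trans (assoc _ _ _)
  | inr M ih => exact (congrArg (· ≫ _) (ih r w h)).trans (assoc _ _ _)
  | case M N₁ N₂ ih ih₁ ih₂ =>
    simp only [RTm.rename, rinterp, ih r w h, ih₁ _ _ (varInterp_liftRen _ r w h _),
      ih₂ _ _ (varInterp_liftRen _ r w h _)]
    exact lift_comp_caseMor _ _ _ _
  | lam M ih =>
    simp only [RTm.rename, rinterp, ih _ _ (varInterp_liftRen _ r w h _)]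
    exact (comp_lam' _ _).symm
  | app M N ihM ihN =>
    exact (congrArg₂ app (ihM r w h) (ihN r w h)).trans (comp_app _ _ _).symm
  | letrec M N ihM ihN =>
    simp only [RTm.rename, rinterp, ihN _ _ (varInterp_liftRen _ r w h _),
      ihM _ _ (varInterp_liftRen _ _ _ (varInterp_liftRen _ r w h _) _)]
    exact 𝒜.pl.lift_comp_fix_lam _ _ _ _

theorem LamStructure.rinterp_wk {Γ : List (RTy S.B)} {ρ : RTy S.B} (σ : RTy S.B) (M : RTm S Γ ρ) :
    𝒜.rinterp ν (M.wk σ) = fst _ _ ≫ 𝒜.rinterp ν M :=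
  𝒜.rinterp_rename ν M (fun _ => Var.succ) (fst _ _) fun _ _ => rfl

theorem LamStructure.rinterp_wk_wk {Γ : List (RTy S.B)} {ρ : RTy S.B} (σ τ : RTy S.B)
    (M : RTm S Γ ρ) : 𝒜.rinterp ν ((M.wk σ).wk τ) = fst _ _ ≫ fst _ _ ≫ 𝒜.rinterp ν M :=
  (𝒜.rinterp_wk ν τ _).trans (congrArg (fst _ _ ≫ ·) (𝒜.rinterp_wk ν σ M))

/-- The form of `rinterp_rename` for a branch of a case analysis, with the lifted `w` written as a
pairing. -/
theorem LamStructure.rinterp_rename_liftRen {Γ Δ : List (RTy S.B)} {ρ σ : RTy S.B}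
    (M : RTm S (σ :: Γ) ρ) (r : ∀ τ, Var Γ τ → Var Δ τ) (w : 𝒜.rctx ν Δ ⟶ 𝒜.rctx ν Γ)
    (h : ∀ τ (x : Var Γ τ), varInterp (𝒜.rty ν) (r τ x) = w ≫ varInterp (𝒜.rty ν) x) :
    𝒜.rinterp ν (M.rename (liftRen r σ)) =
      lift (fst (𝒜.rctx ν Δ) (𝒜.rty ν σ) ≫ w) (snd _ _) ≫ 𝒜.rinterp ν M :=
  (𝒜.rinterp_rename ν M _ _ (varInterp_liftRen _ r w h σ)).trans
    (congrArg (· ≫ 𝒜.rinterp ν M) (whiskerRight_eq_lift w (𝒜.rty ν σ)))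

theorem LamStructure.rinterp_liftSub {Γ Δ : List (RTy S.B)} (s : ∀ τ, Var Γ τ → RTm S Δ τ)
    (w : 𝒜.rctx ν Δ ⟶ 𝒜.rctx ν Γ)
    (h : ∀ τ (x : Var Γ τ), 𝒜.rinterp ν (s τ x) = w ≫ varInterp (𝒜.rty ν) x) (σ : RTy S.B) :
    ∀ τ (x : Var (σ :: Γ) τ),
      𝒜.rinterp ν (liftSub s σ τ x) = w ▷ 𝒜.rty ν σ ≫ varInterp (𝒜.rty ν) x
  | _, .zero => (whiskerRight_snd _ _).symm
  | _, .succ x => by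
    change 𝒜.rinterp ν ((s _ x).wk σ) = w ▷ 𝒜.rty ν σ ≫ fst _ _ ≫ varInterp (𝒜.rty ν) x
    rw [rinterp_wk, h, whiskerRight_fst_assoc]

/-- Substitution is interpreted by precomposition with any `w` that realises it on variables. -/
theorem LamStructure.rinterp_subst {Γ Δ : List (RTy S.B)} {ρ : RTy S.B} (M : RTm S Γ ρ)
    (s : ∀ τ, Var Γ τ → RTm S Δ τ) (w : 𝒜.rctx ν Δ ⟶ 𝒜.rctx ν Γ)
    (h : ∀ τ (x : Var Γ τ), 𝒜.rinterp ν (s τ x) = w ≫ varInterp (𝒜.rty ν) x) :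
    𝒜.rinterp ν (M.subst s) = w ≫ 𝒜.rinterp ν M := by
  induction M generalizing Δ with
  | var x => exact h _ x
  | const c M ih => simp only [RTm.subst, rinterp, ih s w h, assoc]
  | op o M ih => simp only [RTm.subst, rinterp, ih s w h, assoc]
  | unit => exact (comp_toUnit _).symm
  | pair M N ihM ihN =>
    exact (congrArg₂ lift (ihM s w h) (ihN s w h)).trans (comp_lift _ _ _).symm
  | fst M ih => exact (congrArg (· ≫ _) (ih s w h)).trans (assoc _ _ _)
  | snd M ih => exact (congrArg (· ≫ _) (ih s w h)).trans (assoc _ _ _)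
  | abort M ih => exact (congrArg (· ≫ _) (ih s w h)).trans (assoc _ _ _)
  | inl M ih => exact (congrArg (· ≫ _) (ih s w h)).trans (assoc _ _ _)
  | inr M ih => exact (congrArg (· ≫ _) (ih s w h)).trans (assoc _ _ _)
  | case M N₁ N₂ ih ih₁ ih₂ =>
    simp only [RTm.subst, rinterp, ih s w h, ih₁ _ _ (𝒜.rinterp_liftSub ν s w h _),
      ih₂ _ _ (𝒜.rinterp_liftSub ν s w h _)]
    exact lift_comp_caseMor _ _ _ _
  | lam M ih =>
    simp only [RTm.subst, rinterp, ih _ _ (𝒜.rinterp_liftSub ν s w h _)]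
    exact (comp_lam' _ _).symm
  | app M N ihM ihN =>
    exact (congrArg₂ app (ihM s w h) (ihN s w h)).trans (comp_app _ _ _).symm
  | letrec M N ihM ihN =>
    simp only [RTm.subst, rinterp, ihN _ _ (𝒜.rinterp_liftSub ν s w h _),
      ihM _ _ (𝒜.rinterp_liftSub ν _ _ (𝒜.rinterp_liftSub ν s w h _) _)]
    exact 𝒜.pl.lift_comp_fix_lam _ _ _ _

theorem LamStructure.rinterp_castTy {Γ : List (RTy S.B)} {ρ τ : RTy S.B} (h : ρ = τ)
    (M : RTm S Γ ρ) :
    𝒜.rinterp ν (M.castTy h) = 𝒜.rinterp ν M ≫ eqToHom (congrArg (𝒜.rty ν) h) := by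
  subst h
  exact (comp_id _).symm

/-- The substitution of the components of a pair for two variables is interpreted by
reassociation. -/
theorem LamStructure.rinterp_subst_splitSub {Γ : List (RTy S.B)} {ρ τ σ : RTy S.B}
    (M : RTm S (τ :: ρ :: Γ) σ) :
    𝒜.rinterp ν (M.subst splitSub) = lift (lift (fst _ _) (snd _ _ ≫ fst _ _)) (snd _ _ ≫ snd _ _) ≫
      𝒜.rinterp ν M := by
  refine 𝒜.rinterp_subst ν M _ _ fun τ' x => ?_
  match x with
  | .zero => exact (lift_snd _ _).symm
  | .succ .zero =>
    change snd _ _ ≫ fst _ _ = lift (lift _ _) _ ≫ fst _ _ ≫ snd _ _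
    exact ((lift_fst_assoc _ _ _).trans (lift_snd _ _)).symm
  | .succ (.succ x) =>
    change fst _ _ ≫ varInterp _ x = lift (lift _ _) _ ≫ fst _ _ ≫ fst _ _ ≫ varInterp _ x
    exact ((lift_fst_assoc _ _ _).trans (lift_fst_assoc _ _ _)).symm

end Substitution

/-! ### The continuation monad -/

section Continuation

variable {C : Type u} [Category.{v} C] [CartesianMonoidalCategory C] [MonoidalClosed C]

section

variable {Ω W W' P P' Q Q' : C} {w : W ⟶ W'}

/-- Values: the unit of `K_Ω` at `x'` is `λ k. k x`. -/
theorem cps_unit_eq {p : P ⟶ P'} {x : W ⟶ P} {x' : W' ⟶ P'} (h : w ≫ x' = x ≫ p) :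
    w ≫ x' ≫ (contMonad Ω).η.app P' = lam (app (snd _ _) (fst _ _ ≫ x)) ≫ (contMonad Ω).map p := by
  rw [reassoc_of% h]
  apply exp_ext
  simp [contMonad, comp_app, comp_lam, app_lam, comp_lift, comp_lift_assoc]

/-- Applying an effect-free `f` to the result of `m` is `λ k. m (λ y. k (f y))`. It serves for
constants, projections and injections. -/
theorem cps_map_eq {p : P ⟶ P'} {q : Q ⟶ Q'} {f : P ⟶ Q} {f' : P' ⟶ Q'}
    {m : W ⟶ Exp (Exp P Ω) Ω} {m' : W' ⟶ Exp (Exp P' Ω) Ω}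
    (h : w ≫ m' = m ≫ (contMonad Ω).map p) (hf : p ≫ f' = f ≫ q) :
    w ≫ m' ≫ (contMonad Ω).map f' =
      lam (app (fst _ _ ≫ m) (lam (app (fst _ _ ≫ snd _ _) (snd _ _ ≫ f)))) ≫
        (contMonad Ω).map q := by
  dsimp only [contMonad] at h ⊢
  rw [reassoc_of% h]
  apply exp_ext
  simp [comp_app, comp_lam, app_lam, comp_lift, comp_lift_assoc, hf]

/-- Sequencing from left to right in `K_Ω` is `λ k. m (λ y. n (λ z. k (y, z)))`. -/
theorem cps_pair_eq {p : P ⟶ P'} {q : Q ⟶ Q'}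
    {m : W ⟶ Exp (Exp P Ω) Ω} {m' : W' ⟶ Exp (Exp P' Ω) Ω}
    {n : W ⟶ Exp (Exp Q Ω) Ω} {n' : W' ⟶ Exp (Exp Q' Ω) Ω}
    (hm : w ≫ m' = m ≫ (contMonad Ω).map p) (hn : w ≫ n' = n ≫ (contMonad Ω).map q) :
    w ≫ lift m' n' ≫ (contMonad Ω).seq P' Q' =
      lam (app (fst _ _ ≫ m) (lam (app (fst _ _ ≫ fst _ _ ≫ n)
        (lam (app (fst _ _ ≫ fst _ _ ≫ snd _ _) (lift (fst _ _ ≫ snd _ _) (snd _ _))))))) ≫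
        (contMonad Ω).map (p ⊗ₘ q) := by
  dsimp only [contMonad, StrongMonad.seq] at hm hn ⊢
  rw [comp_lift_assoc, hm, hn]
  apply exp_ext
  simp [comp_app, comp_lam, app_lam, comp_lift, comp_lift_assoc]

/-- Call-by-value application in `K_Ω` is `λ k. m (λ f. n (λ y. f (y, k)))`, where `f` takes the
pair of its argument and its continuation. -/
theorem cps_app_eq {a : P ≅ P'} {b : Q ≅ Q'}
    {m : W ⟶ Exp (Exp (Exp (P ⊗ Exp Q Ω) Ω) Ω) Ω}
    {m' : W' ⟶ Exp (Exp (Exp P' (Exp (Exp Q' Ω) Ω)) Ω) Ω}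
    {n : W ⟶ Exp (Exp P Ω) Ω} {n' : W' ⟶ Exp (Exp P' Ω) Ω}
    (hm : w ≫ m' = m ≫ (contMonad Ω).map (arrowIso Ω a b).hom)
    (hn : w ≫ n' = n ≫ (contMonad Ω).map a.hom) :
    w ≫ lift m' n' ≫ (contMonad Ω).seq _ _ ≫ (contMonad Ω).map (ev _ _) ≫
        (contMonad Ω).μ.app Q' =
      lam (app (fst _ _ ≫ m) (lam (app (fst _ _ ≫ fst _ _ ≫ n)
        (lam (app (fst _ _ ≫ snd _ _) (lift (snd _ _) (fst _ _ ≫ fst _ _ ≫ snd _ _))))))) ≫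
        (contMonad Ω).map b.hom := by
  have hev : ev P' (Exp (Exp Q' Ω) Ω) = app (fst _ _) (snd _ _) := by simp [app]
  dsimp only [contMonad, StrongMonad.seq] at hm hn ⊢
  rw [comp_lift_assoc, hm, hn, hev]
  apply exp_ext
  simp [arrowIso, comp_app, comp_lam, app_lam, comp_lift, comp_lift_assoc]

/-- Interpreting `λ (x, h). M h` and transporting it along `arrowIso` is the same as interpreting
`λ x. M` after a change of context. -/
theorem lam_arrowIso_hom {a : P ≅ P'} {b : Q ≅ Q'} {m : W ⊗ P ⟶ Exp (Exp Q Ω) Ω}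
    {m' : W' ⊗ P' ⟶ Exp (Exp Q' Ω) Ω}
    (h : (w ⊗ₘ a.hom) ≫ m' = m ≫ (contMonad Ω).map b.hom) :
    w ≫ lam m' = lam (lift (lift (fst _ _) (snd _ _ ≫ fst _ _)) (snd _ _ ≫ snd _ _) ≫
      app (fst _ _ ≫ m) (snd _ _)) ≫ (arrowIso Ω a b).hom := by
  dsimp only [contMonad] at h
  have h' : w ▷ P' ≫ m' = W ◁ a.inv ≫ (w ⊗ₘ a.hom) ≫ m' := by
    rw [← assoc]
    congr 1
    ext <;> simp
  rw [comp_lam', h', h]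
  apply exp_ext
  apply exp_ext
  simp [arrowIso, comp_app, comp_lam, app_lam, comp_lift, comp_lift_assoc]

/-- Weakening of the abstraction in `lam_arrowIso_hom` by the variable `k` of
`λ k. k (λ (x, h). M h)`. -/
theorem fst_comp_lam_split {K : C} (m : W ⊗ P ⟶ Exp (Exp Q Ω) Ω) :
    fst W K ≫ lam (lift (lift (fst _ _) (snd _ _ ≫ fst _ _)) (snd _ _ ≫ snd _ _) ≫
        app (fst _ _ ≫ m) (snd _ _)) =
      lam (lift (lift (fst _ _) (snd _ _ ≫ fst _ _)) (snd _ _ ≫ snd _ _) ≫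
        app (fst _ _ ≫ lift (fst _ _ ≫ fst _ _) (snd _ _) ≫ m) (snd _ _)) := by
  simp [comp_app, comp_lam, comp_lift_assoc]

/-- The operation of `K_Ω` with generic effect `e ↦ λ j. A (j, g e)`, against the CPS image
`λ k. m (λ (m₁, m₂). A (λ x. m₁ (x, k), g m₂))` of an operation; `A` plays the role of
`ν ∘ T ev ∘ st`. -/
theorem cps_op_eq {D E G : C} {b : Q ≅ Q'} (g : E ⟶ G) (A : Exp D Ω ⊗ G ⟶ Ω)
    {m : W ⟶ Exp (Exp (Exp (D ⊗ Exp Q Ω) Ω ⊗ E) Ω) Ω}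
    {m' : W' ⟶ Exp (Exp (Exp D (Exp (Exp Q' Ω) Ω) ⊗ E) Ω) Ω}
    (hm : w ≫ m' = m ≫ (contMonad Ω).map ((arrowIso Ω (Iso.refl D) b).hom ⊗ₘ 𝟙 E)) :
    w ≫ m' ≫ (contMonad Ω).map (unlam ((AlgOp.ofGef (T := contMonad Ω)
        (g ≫ lam (lift (snd _ _) (fst _ _) ≫ A))).app Q')) ≫ (contMonad Ω).μ.app Q' =
      lam (app (fst _ _ ≫ m) (lam (lift (lift (fst _ _) (snd _ _ ≫ fst _ _)) (snd _ _ ≫ snd _ _) ≫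
        lift (lam (app (fst _ _ ≫ fst _ _ ≫ snd _ _) (lift (snd _ _)
          (fst _ _ ≫ fst _ _ ≫ fst _ _ ≫ snd _ _)))) (snd _ _) ≫ _ ◁ g ≫ A))) ≫
        (contMonad Ω).map b.hom := by
  have hev : ev D (Exp (Exp Q' Ω) Ω) = app (fst _ _) (snd _ _) := by simp [app]
  dsimp only [contMonad, AlgOp.ofGef, kleisliEv] at hm ⊢
  rw [reassoc_of% hm, hev, unlam_lam]
  apply exp_ext
  simp [arrowIso, comp_app, comp_lam, app_lam, comp_lift, comp_lift_assoc]

end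

/-- `X ⊗ -` preserves the initial object; only the uniqueness of maps out of `X ⊗ 0` is used. -/
theorem tensor_initial_hom_ext [HasInitial C] {X Z : C} (f g : X ⊗ ⊥_ C ⟶ Z) : f = g :=
  MonoidalClosed.curry_injective (initial.hom_ext _ _)

/-- The continuation of an empty case analysis is a map out of `W ⊗ (Q ⇒ Ω) ⊗ 0`, so it is
unique. -/
theorem cps_abort_eq [HasInitial C] {Ω W W' Q Q' : C} {w : W ⟶ W'}
    {m : W ⟶ Exp (Exp (⊥_ C) Ω) Ω} {m' : W' ⟶ Exp (Exp (⊥_ C) Ω) Ω} {q : Q ⟶ Q'}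
    (h : w ≫ m' = m ≫ (contMonad Ω).map (𝟙 _)) :
    w ≫ m' ≫ (contMonad Ω).map (initial.to Q') =
      lam (app (fst _ _ ≫ m) (lam (snd _ _ ≫ initial.to Ω))) ≫ (contMonad Ω).map q := by
  dsimp only [contMonad] at h ⊢
  rw [reassoc_of% h]
  apply exp_ext
  simp only [comp_app, comp_lam, app_lam, comp_lift, comp_lift_assoc, lift_fst, lift_snd,
    lift_fst_assoc, lift_snd_assoc, id_comp, comp_id, assoc, lift_fst_snd]
  exact congrArg (app _) (congrArg lam (tensor_initial_hom_ext _ _))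

section Coproducts

variable [HasBinaryCoproducts C] {Ω W W' P₁ P₁' P₂ P₂' Q Q' : C} {w : W ⟶ W'}

theorem lift_inl_caseMor {V X Y₁ Y₂ Z : C} (x : V ⟶ X) (y : V ⟶ Y₁) (f : X ⊗ Y₁ ⟶ Z)
    (g : X ⊗ Y₂ ⟶ Z) : lift x (y ≫ coprod.inl) ≫ caseMor f g = lift x y ≫ f := by
  rw [← lift_whiskerLeft_assoc, inl_caseMor]

theorem lift_inr_caseMor {V X Y₁ Y₂ Z : C} (x : V ⟶ X) (y : V ⟶ Y₂) (f : X ⊗ Y₁ ⟶ Z)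
    (g : X ⊗ Y₂ ⟶ Z) : lift x (y ≫ coprod.inr) ≫ caseMor f g = lift x y ≫ g := by
  rw [← lift_whiskerLeft_assoc, inr_caseMor]

/-- Products distribute over coproducts in a cartesian closed category, so that maps out of
`X ⊗ (Y₁ ⨿ Y₂)` can be compared on the two summands. -/
theorem tensor_coprod_hom_ext {X Y₁ Y₂ Z : C} {f g : X ⊗ (Y₁ ⨿ Y₂) ⟶ Z}
    (h₁ : lift (fst X Y₁) (snd X Y₁ ≫ coprod.inl) ≫ f =
      lift (fst X Y₁) (snd X Y₁ ≫ coprod.inl) ≫ g)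
    (h₂ : lift (fst X Y₂) (snd X Y₂ ≫ coprod.inr) ≫ f =
      lift (fst X Y₂) (snd X Y₂ ≫ coprod.inr) ≫ g) : f = g := by
  have e : ∀ {Y Z : C} (i : Y ⟶ Z), lift (fst X Y) (snd X Y ≫ i) = X ◁ i := by
    intro Y Z i
    ext <;> simp
  rw [e] at h₁ h₂
  apply MonoidalClosed.curry_injective
  ext
  · rw [← MonoidalClosed.curry_natural_left, ← MonoidalClosed.curry_natural_left, h₁]
  · rw [← MonoidalClosed.curry_natural_left, ← MonoidalClosed.curry_natural_left, h₂]

/-- Case analysis in `K_Ω` is `λ k. m (λ y. δ(y, x₁. f x₁ k, x₂. g x₂ k))`. -/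
theorem cps_case_eq {p₁ : P₁ ⟶ P₁'} {p₂ : P₂ ⟶ P₂'} {q : Q ⟶ Q'}
    {m : W ⟶ Exp (Exp (P₁ ⨿ P₂) Ω) Ω} {m' : W' ⟶ Exp (Exp (P₁' ⨿ P₂') Ω) Ω}
    {f : W ⊗ P₁ ⟶ Exp (Exp Q Ω) Ω} {f' : W' ⊗ P₁' ⟶ Exp (Exp Q' Ω) Ω}
    {g : W ⊗ P₂ ⟶ Exp (Exp Q Ω) Ω} {g' : W' ⊗ P₂' ⟶ Exp (Exp Q' Ω) Ω}
    (hm : w ≫ m' = m ≫ (contMonad Ω).map (coprod.map p₁ p₂))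
    (hf : (w ⊗ₘ p₁) ≫ f' = f ≫ (contMonad Ω).map q)
    (hg : (w ⊗ₘ p₂) ≫ g' = g ≫ (contMonad Ω).map q) :
    w ≫ lift (𝟙 W') m' ≫ (contMonad Ω).str W' (P₁' ⨿ P₂') ≫ (contMonad Ω).map (caseMor f' g') ≫
        (contMonad Ω).μ.app Q' =
      lam (app (fst _ _ ≫ m) (lam (lift (𝟙 _) (snd _ _) ≫ caseMor
        (app (lift (fst _ _ ≫ fst _ _ ≫ fst _ _) (snd _ _) ≫ f) (fst _ _ ≫ fst _ _ ≫ snd _ _))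
        (app (lift (fst _ _ ≫ fst _ _ ≫ fst _ _) (snd _ _) ≫ g) (fst _ _ ≫ fst _ _ ≫ snd _ _))))) ≫
        (contMonad Ω).map q := by
  dsimp only [contMonad, Functor.comp_obj] at hm hf hg ⊢
  -- The hypotheses on the branches at generalised elements `x`, `y`, a form that still applies once
  -- composites of pairings have been merged into one pairing.
  have hf' := fun (V : C) (x : V ⟶ W) (y : V ⟶ P₁) =>
    (lift_map_assoc x y w p₁ f').symm.trans (congrArg (lift x y ≫ ·) hf)
  have hg' := fun (V : C) (x : V ⟶ W) (y : V ⟶ P₂) =>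
    (lift_map_assoc x y w p₂ g').symm.trans (congrArg (lift x y ≫ ·) hg)
  rw [comp_lift_assoc, hm]
  apply exp_ext
  simp only [comp_app, comp_lam, app_lam, comp_lift, comp_lift_assoc, lift_fst, lift_snd,
    lift_fst_assoc, lift_snd_assoc, id_comp, comp_id, assoc, lift_fst_snd]
  -- Both sides apply `m` to a continuation on `P₁ ⨿ P₂`; the two continuations agree on the
  -- summands.
  refine congrArg (fun t => app (fst W (Exp Q' Ω) ≫ m) (lam t)) ?_
  refine tensor_coprod_hom_ext ?_ ?_
  · simp only [comp_app, comp_lift_assoc, lift_fst, lift_snd, lift_fst_assoc, lift_snd_assoc, assoc,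
      coprod.inl_map, lift_inl_caseMor, comp_lift]
    simp only [← assoc, lift_inl_caseMor, hf']
    simp [comp_app, comp_lam, app_lam, comp_lift, comp_lift_assoc]
  · simp only [comp_app, comp_lift_assoc, lift_fst, lift_snd, lift_fst_assoc, lift_snd_assoc, assoc,
      coprod.inr_map, lift_inr_caseMor, comp_lift]
    simp only [← assoc, lift_inr_caseMor, hg']
    simp [comp_app, comp_lam, app_lam, comp_lift, comp_lift_assoc]

end Coproducts

end Continuation

/-! ### Ground types -/

section Casts

variable {C : Type u} [Category.{v} C]

theorem tensorHom_eqToHom [CartesianMonoidalCategory C] {X X' Y Y' : C} (h : X = X') (h' : Y = Y') :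
    eqToHom h ⊗ₘ eqToHom h' = eqToHom (by rw [h, h'] : X ⊗ Y = X' ⊗ Y') := by
  subst h h'
  simp

/-- A morphism `k` between ground types is read in two ways, with casts between equal objects
around it; the readings agree by proof irrelevance of the equalities. -/
theorem eqToHom_sandwich {G G' D₁ D₂ D₃ E₁ E₂ E₃ : C} (h₁ : D₁ = D₂) (h₂ : D₂ = G) (k : G ⟶ G')
    (h₃ : G' = E₂) (h₄ : D₁ = D₃) (h₅ : D₃ = G) (h₆ : G' = E₃) (h₇ : E₃ = E₁) (h₈ : E₁ = E₂) :
    eqToHom h₁ ≫ (eqToHom h₂ ≫ k ≫ eqToHom h₃) =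
      ((eqToHom h₄ ≫ eqToHom h₅ ≫ k ≫ eqToHom h₆) ≫ eqToHom h₇) ≫ eqToHom h₈ := by
  simp

theorem coprod_map_eqToHom [HasBinaryCoproducts C] {X X' Y Y' : C} (h : X = X') (h' : Y = Y') :
    coprod.map (eqToHom h) (eqToHom h') = eqToHom (by rw [h, h'] : (X ⨿ Y) = (X' ⨿ Y')) := by
  subst h h'
  simp

end Casts

section Ground

variable {C : Type u} [Category.{v} C] [CartesianMonoidalCategory C] [MonoidalClosed C]

/-- The identity `cps_op_eq` with the casts that occur in the clauses for operations. A ground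
type has four interpretations, equal but not by definition: directly (`D`, `E`), as the CPS image
of a source type (`Dc`, `Ec`), as a target type (`Dr`, `Er`) and as a source type (`Ds`, `Es`).
With the objects as variables the equalities can be eliminated, whereupon all casts become
identities. -/
theorem cps_op_cast_eq {Ω W W' Q Q' D Dc Dr Ds E Ec Er Es G : C} {w : W ⟶ W'} {b : Q ≅ Q'}
    (hDc : Dc = D) (hDr : Dr = D) (hDs : Ds = D) (hEc : Ec = E) (hEr : Er = E) (hEs : Es = E)
    {a : Dc ≅ Ds} {c : Ec ≅ Es} (ha : a.hom = eqToHom (hDc.trans hDs.symm))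
    (hc : c.hom = eqToHom (hEc.trans hEs.symm)) (g : E ⟶ G) (A : Exp D Ω ⊗ G ⟶ Ω)
    {m : W ⟶ Exp (Exp (Exp (Dc ⊗ Exp Q Ω) Ω ⊗ Ec) Ω) Ω}
    {m' : W' ⟶ Exp (Exp (Exp Ds (Exp (Exp Q' Ω) Ω) ⊗ Es) Ω) Ω}
    (hm : w ≫ m' = m ≫ (contMonad Ω).map ((arrowIso Ω a b).hom ⊗ₘ c.hom))
    (h₁ : Exp Ds (Exp (Exp Q' Ω) Ω) ⊗ Es = Exp D (Exp (Exp Q' Ω) Ω) ⊗ E) (h₂ : Dr = Dc)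
    (h₃ : Ec = Er) (h₄ : Exp Dr Ω ⊗ Er = Exp D Ω ⊗ E) :
    w ≫ m' ≫ (contMonad Ω).map (eqToHom h₁ ≫ unlam ((AlgOp.ofGef (T := contMonad Ω)
        (g ≫ lam (lift (snd _ _) (fst _ _) ≫ A))).app Q')) ≫ (contMonad Ω).μ.app Q' =
      lam (app (fst _ _ ≫ m) (lam (lift (lift (fst _ _) (snd _ _ ≫ fst _ _)) (snd _ _ ≫ snd _ _) ≫
        lift (lam (app (fst _ _ ≫ fst _ _ ≫ snd _ _) (lift (snd _ _ ≫ eqToHom h₂)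
          (fst _ _ ≫ fst _ _ ≫ fst _ _ ≫ snd _ _)))) (snd _ _ ≫ eqToHom h₃) ≫
            eqToHom h₄ ≫ _ ◁ g ≫ A))) ≫ (contMonad Ω).map b.hom := by
  subst hDc hDr hEc hEr
  subst hDs hEs
  obtain rfl : a = Iso.refl _ := Iso.ext ha
  obtain rfl : c = Iso.refl _ := Iso.ext hc
  simpa using cps_op_eq g A hm

end Ground

/-! ### The comparison of the two interpretations -/

section Main

variable {C : Type u} [Category.{v} C] [CartesianMonoidalCategory C] [MonoidalClosed C]
  [HasInitial C] [HasBinaryCoproducts C] [OmegaCPOEnriched C]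
  {S : Signature.{uB, uK, uO}} (𝒜 : LamStructure C S)
  (ν : 𝒜.T.toMonad.Algebra)

theorem LamStructure.psi_toTy_hom (g : GTy S.B) :
    (𝒜.psi ν g.toTy).hom = eqToHom (𝒜.rty_cpsTy_toTy ν g) := by
  induction g with
  | base b => rfl
  | unit => rfl
  | empty => rfl
  | prod ρ τ h₁ h₂ => exact (congrArg₂ (· ⊗ₘ ·) h₁ h₂).trans (tensorHom_eqToHom _ _)
  | sum ρ τ h₁ h₂ => exact (congrArg₂ coprod.map h₁ h₂).trans (coprod_map_eqToHom _ _)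

theorem LamStructure.psiCtx_hom_varInterp {Γ : List (Ty S.B)} {ρ : Ty S.B} (x : Var Γ ρ) :
    (𝒜.psiCtx ν Γ).hom ≫ varInterp (𝒜.cont ν).ty x =
      varInterp (𝒜.rty ν) (cpsVar x) ≫ (𝒜.psi ν ρ).hom := by
  induction x with
  | zero => exact tensorHom_snd _ _
  | succ x ih =>
    refine (tensorHom_fst_assoc _ _ _).trans ?_
    exact (congrArg (fst _ _ ≫ ·) ih).trans (assoc _ _ _).symm

/-- The two interpretations agree along `ψ`. In each case the identity for the term former is
applied to the induction hypotheses, and what remains is to recognise the result as the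
interpretation of `cps M`, by the lemmas on renaming and substitution. -/
theorem LamStructure.psiCtx_comp_interp {Γ : List (Ty S.B)} {ρ : Ty S.B} (M : Tm S Γ ρ) :
    (𝒜.psiCtx ν Γ).hom ≫ (𝒜.cont ν).interp M =
      𝒜.rinterp ν (cps M) ≫ (contMonad ν.A).map (𝒜.psi ν ρ).hom := by
  induction M with
  | @var Γ ρ x =>
    exact (cps_unit_eq (𝒜.psiCtx_hom_varInterp ν x)).trans (congrArg (fun t => lam (app _ t) ≫ _)
      (𝒜.rinterp_wk ν (.pred (cpsTy ρ)) (.var (cpsVar x))).symm)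
  | @const Γ c M ih =>
    -- The constant commutes with `ψ`, which at ground types is a cast.
    have hf := ((congrArg (· ≫ _) (𝒜.psi_toTy_hom ν (S.arK c))).trans
      (eqToHom_sandwich _ (tyInterp_toTy _ 𝒜.A (S.arK c)) (𝒜.aK c)
        (tyInterp_toTy (𝒜.cont ν).T 𝒜.A (S.carK c)).symm
        (congrArg (𝒜.rty ν) (cpsTy_toTy (S.arK c)))
        (rtyInterp_toRTy ν.A 𝒜.A (S.arK c)) (rtyInterp_toRTy ν.A 𝒜.A (S.carK c)).symm
        (congrArg (𝒜.rty ν) (cpsTy_toTy (S.carK c)).symm) _)).trans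
      (congrArg (_ ≫ ·) (𝒜.psi_toTy_hom ν (S.carK c)).symm)
    refine (cps_map_eq ih hf).trans ?_
    refine congrArg₂ (fun s t => lam (app s (lam (app _ t))) ≫ _)
      (𝒜.rinterp_wk ν (.pred (cpsTy (S.carK c).toTy)) (cps M)).symm ?_
    have e₁ := 𝒜.rinterp_castTy ν (cpsTy_toTy (S.arK c))
      (RTm.var (Γ := cpsTy (S.arK c).toTy :: .pred (cpsTy (S.carK c).toTy) :: cpsCtx Γ) .zero)
    have e₂ := 𝒜.rinterp_castTy ν (cpsTy_toTy (S.carK c)).symm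
      (.const c (.castTy (cpsTy_toTy (S.arK c)) (RTm.var
        (Γ := cpsTy (S.arK c).toTy :: .pred (cpsTy (S.carK c).toTy) :: cpsCtx Γ) .zero)))
    refine Eq.trans ?_ e₂.symm
    refine (assoc _ _ _).symm.trans (congrArg (· ≫ _) ?_)
    exact (assoc _ _ _).symm.trans (congrArg (· ≫ _) e₁.symm)
  | @op Γ o ρ M ih =>
    refine (cps_op_cast_eq ((congrArg (𝒜.rty ν) (cpsTy_toTy _)).trans (rtyInterp_toRTy ν.A 𝒜.A _))
      (rtyInterp_toRTy ν.A 𝒜.A _) (tyInterp_toTy _ 𝒜.A _)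
      ((congrArg (𝒜.rty ν) (cpsTy_toTy _)).trans (rtyInterp_toRTy ν.A 𝒜.A _))
      (rtyInterp_toRTy ν.A 𝒜.A _) (tyInterp_toTy _ 𝒜.A _)
      (𝒜.psi_toTy_hom ν (S.arO o)) (𝒜.psi_toTy_hom ν (S.carO o)) (𝒜.aO o).gef (algEv 𝒜.T ν _) ih _
      (congrArg (𝒜.rty ν) (cpsTy_toTy (S.arO o)).symm)
      (congrArg (𝒜.rty ν) (cpsTy_toTy (S.carO o)))
      (by simp only [rtyInterp, rtyInterp_toRTy])).trans ?_
    refine congrArg₂ (fun s t => lam (app s (lam t)) ≫ _)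
      (𝒜.rinterp_wk ν (.pred (cpsTy ρ)) (cps M)).symm ?_
    refine Eq.trans ?_ (𝒜.rinterp_subst_splitSub ν
      (Γ := .pred (cpsTy ρ) :: cpsCtx Γ) (σ := .ans)
      (ρ := .pred (.prod (cpsTy (S.arO o).toTy) (.pred (cpsTy ρ))))
      (τ := cpsTy (S.carO o).toTy) _).symm
    have e₁ := 𝒜.rinterp_castTy ν (cpsTy_toTy (S.arO o)).symm (RTm.var (Γ := (S.arO o).toRTy ::
      cpsTy (S.carO o).toTy :: .pred (.prod (cpsTy (S.arO o).toTy) (.pred (cpsTy ρ))) ::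
        .pred (cpsTy ρ) :: cpsCtx Γ) .zero)
    have e₂ := 𝒜.rinterp_castTy ν (cpsTy_toTy (S.carO o)) (RTm.var (Γ :=
      cpsTy (S.carO o).toTy :: .pred (.prod (cpsTy (S.arO o).toTy) (.pred (cpsTy ρ))) ::
        .pred (cpsTy ρ) :: cpsCtx Γ) .zero)
    exact congrArg₂ (fun s t => lift (lift (fst _ _) (snd _ _ ≫ fst _ _)) (snd _ _ ≫ snd _ _) ≫
      lift (lam (app _ (lift s _))) t ≫ _) e₁.symm e₂.symm
  | unit =>
    -- `ψ` at the unit type is the identity, and any two maps into it agree.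
    refine (cps_unit_eq (p := 𝟙 (𝟙_ C)) (x := toUnit _) (toUnit_unique _ _)).trans ?_
    exact congrArg (fun t => lam (app _ t) ≫ _) (toUnit_unique _ _)
  | @pair Γ ρ τ M N ihM ihN =>
    refine (cps_pair_eq ihM ihN).trans ?_
    exact congrArg₂ (fun s t => lam (app s (lam (app t _))) ≫ _)
      (𝒜.rinterp_wk ν (.pred (cpsTy (.prod ρ τ))) (cps M)).symm
      (𝒜.rinterp_wk_wk ν (.pred (cpsTy (.prod ρ τ))) (cpsTy ρ) (cps N)).symm
  | @fst Γ ρ τ M ih =>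
    refine (cps_map_eq ih (tensorHom_fst _ _)).trans ?_
    exact congrArg (fun t => lam (app t _) ≫ _) (𝒜.rinterp_wk ν (.pred (cpsTy ρ)) (cps M)).symm
  | @snd Γ ρ τ M ih =>
    refine (cps_map_eq ih (tensorHom_snd _ _)).trans ?_
    exact congrArg (fun t => lam (app t _) ≫ _) (𝒜.rinterp_wk ν (.pred (cpsTy τ)) (cps M)).symm
  | @abort Γ ρ M ih =>
    refine (cps_abort_eq (q := (𝒜.psi ν ρ).hom) ih).trans ?_
    exact congrArg (fun t => lam (app t _) ≫ _) (𝒜.rinterp_wk ν (.pred (cpsTy ρ)) (cps M)).symm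
  | @inl Γ ρ τ M ih =>
    refine (cps_map_eq ih (coprod.inl_map (𝒜.psi ν ρ).hom (𝒜.psi ν τ).hom).symm).trans ?_
    exact congrArg (fun t => lam (app t _) ≫ _)
      (𝒜.rinterp_wk ν (.pred (cpsTy (.sum ρ τ))) (cps M)).symm
  | @inr Γ ρ τ M ih =>
    refine (cps_map_eq ih (coprod.inr_map (𝒜.psi ν ρ).hom (𝒜.psi ν τ).hom).symm).trans ?_
    exact congrArg (fun t => lam (app t _) ≫ _)
      (𝒜.rinterp_wk ν (.pred (cpsTy (.sum ρ τ))) (cps M)).symm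
  | @case Γ ρ₁ ρ₂ τ M M₁ M₂ ih ih₁ ih₂ =>
    refine (cps_case_eq ih ih₁ ih₂).trans ?_
    -- The branches are weakened by `k` and by the scrutinee `m`, below the variable that they bind.
    have e : ∀ (σ : Ty S.B) (N : Tm S (σ :: Γ) τ), _ := fun σ N =>
      𝒜.rinterp_rename_liftRen ν (Δ := cpsTy (.sum ρ₁ ρ₂) :: .pred (cpsTy τ) :: cpsCtx Γ) (cps N)
        (fun _ x => .succ (.succ x)) (fst _ _ ≫ fst _ _)
          fun _ x => (assoc (fst _ _) (fst _ _) (varInterp _ x)).symm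
    refine (congrArg (fun t => lam (app t _) ≫ _)
      (𝒜.rinterp_wk ν (.pred (cpsTy τ)) (cps M)).symm).trans ?_
    exact congrArg₂ (fun s t => lam (app _ (lam (lift (𝟙 _) (snd _ _) ≫
      caseMor (app s _) (app t _)))) ≫ _) (e _ M₁).symm (e _ M₂).symm
  | @lam Γ ρ τ M ih =>
    refine (cps_unit_eq (lam_arrowIso_hom ih)).trans ?_
    refine congrArg (fun t => lam (app (snd _ _) t) ≫ _) ((fst_comp_lam_split _).trans ?_)
    refine congrArg lam (Eq.trans ?_ (𝒜.rinterp_subst_splitSub ν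
      (Γ := .pred (cpsTy (.arrow ρ τ)) :: cpsCtx Γ) (σ := .ans) (ρ := cpsTy ρ)
      (τ := .pred (cpsTy τ)) _).symm)
    have e := 𝒜.rinterp_rename ν (cps M)
      (Δ := .pred (cpsTy τ) :: cpsTy ρ :: .pred (cpsTy (.arrow ρ τ)) :: cpsCtx Γ)
      (fun _ x => .succ (liftRen (fun _ => .succ) _ _ x))
      (fst _ _ ≫ lift (fst _ _ ≫ fst _ _) (snd _ _)) fun _ x =>
        (congrArg (fst _ _ ≫ ·) ((varInterp_liftRen (𝒜.rty ν) (fun _ => .succ) (fst _ _)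
          (fun _ _ => rfl) (cpsTy ρ) _ x).trans (congrArg (· ≫ varInterp (𝒜.rty ν) x)
            (whiskerRight_eq_lift _ _)))).trans (assoc _ _ _).symm
    exact congrArg (fun t => lift (lift (fst _ _) (snd _ _ ≫ fst _ _)) (snd _ _ ≫ snd _ _) ≫
      app t (snd _ _)) (e.trans (assoc _ _ _)).symm
  | @app Γ ρ τ M N ihM ihN =>
    refine (cps_app_eq ihM ihN).trans ?_
    exact congrArg₂ (fun s t => lam (app s (lam (app t _))) ≫ _)
      (𝒜.rinterp_wk ν (.pred (cpsTy τ)) (cps M)).symm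
      (𝒜.rinterp_wk_wk ν (.pred (cpsTy τ)) (cpsTy (.arrow ρ τ)) (cps N)).symm
  | @letrec Γ ρ τ σ M N ihM ihN =>
    -- `f` has the type `ρ → τ` in the source and `(ρ × (τ → R)) → R` in the target; the algebras
    -- on the interpretations are for different monads, and `arrowIso` is only an isomorphism of
    -- carriers.
    refine (𝒜.pl.comp_lift_fix (𝒜.cont ν).pl (expAlgebra 𝒜.T ν _)
      (expAlgebra (𝒜.cont ν).T ((𝒜.cont ν).T.toMonad.free.obj _) _)
      (arrowIso ν.A (𝒜.psi ν ρ) (𝒜.psi ν τ)) (lam_arrowIso_hom ihM) ihN).trans ?_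
    refine congrArg (fun t => (lift (𝟙 _) (𝒜.pl.fix (expAlgebra 𝒜.T ν _) (lam t)) ≫ _) ≫ _) ?_
    refine Eq.trans ?_ (𝒜.rinterp_subst_splitSub ν
      (Γ := cpsTy (.arrow ρ τ) :: cpsCtx Γ) (σ := .ans) (ρ := cpsTy ρ)
      (τ := .pred (cpsTy τ)) _).symm
    exact congrArg (fun t => lift (lift (fst _ _) (snd _ _ ≫ fst _ _)) (snd _ _ ≫ snd _ _) ≫
      app t (snd _ _)) (𝒜.rinterp_wk ν (.pred (cpsTy τ)) (cps M)).symm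

end Main

end LamCPS

theorem mainTheorem7 {C : Type u} [Category.{v} C] [CartesianMonoidalCategory C]
    [MonoidalClosed C] [HasInitial C] [HasBinaryCoproducts C] [LamCPS.OmegaCPOEnriched C]
    (S : LamCPS.Signature.{uB, uK, uO}) (𝒜 : LamCPS.LamStructure C S)
    (ν : 𝒜.T.toMonad.Algebra) :
    (∀ (Γ : List (LamCPS.Ty S.B)) (ρ : LamCPS.Ty S.B) (M : LamCPS.Tm S Γ ρ),
      (𝒜.psiCtx ν Γ).hom ≫ (𝒜.cont ν).interp M =
        𝒜.rinterp ν (LamCPS.cps M) ≫ (LamCPS.contMonad ν.A).map (𝒜.psi ν ρ).hom) ∧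
    (∀ g : LamCPS.GTy S.B,
      (𝒜.psi ν g.toTy).hom = eqToHom (𝒜.rty_cpsTy_toTy ν g)) :=
  ⟨fun _ _ M => 𝒜.psiCtx_comp_interp ν M, fun g => 𝒜.psi_toTy_hom ν g⟩
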